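/- Let $d\ge 2$ be an integer and $0<r_0<r<1$. Let $S^d$ be the unit sphere of $\mathbb R^{d+1}$, $rS^d$ the concentric sphere of radius $r$, $\mu_d$ the ($d$-dimensional, unnormalized) surface measure on these spheres, and $\omega_d=\mu_d(S^d)=2\pi^{(d+1)/2}/\Gamma(\frac{d+1}2)$. Let $Z(d,l)$ be the dimension of the space of spherical harmonics of degree $l$ (restrictions to $S^d$ of homogeneous harmonic polynomials of degree $l$), and let $\{Y_{l,k}: l\ge 0,\ 1\le k\le Z(d,l)\}$ be a real orthonormal basis of $L^2(S^d,\mu_d)$ with $Y_{l,k}$ a spherical harmonic of degree $l$. For a continuous function $g$ on $S^d$ put $\hat g(l,k)=\int_{S^d} g\,Y_{l,k}\,d\mu_d$ and $$D(g)=\sum_{l=0}^\infty\sum_{k=1}^{Z(d,l)}\frac{2l+d-1}{(d-1)\,\omega_d}\,\hat g(l,k)\,Y_{l,k},$$ provided the series converges in $L^2(S^d)$. Let $f:\mathbb R^{d+1}\to\mathbb R$ be harmonic on $\{\|x\|>r\}$, continuous on $\{\|x\|\ge r\}$, with $f(x)\to 0$ as $\|x\|\to\infty$. Put $f_r(\eta)=f(r\eta)$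 for $\eta\in S^d$, and let $D(f)$ be the function on $rS^d$ given by $D(f)(r\eta)=D(f_r)(\eta)$; suppose that $D(f_r)$ exists and that $\|D(f)\|_{L_\infty(rS^d)}<\infty$. Suppose moreover that $f_r(\eta)=\sum_{l=0}^\infty\sum_{k=1}^{Z(d,l)}\hat f_r(l,k)Y_{l,k}(\eta)$ for every $\eta\in S^d$. Let $1\le p,p'\le\infty$ with $\frac1p+\frac1{p'}=1$, and let $\sigma$ be a finite signed Borel measure on $\mathbb R^{d+1}$ whose positive and negative parts $\sigma^{\pm}$ are supported on $S^d$ and have finite energy, $\iint\|x-y\|^{1-d}\,d\sigma^{\pm}(x)\,d\sigma^{\pm}(y)<\infty$. Let $U^\sigma(x)=\int_{S^d}\|x-y\|^{1-d}\,d\sigma(y)$ be its Newtonian potential. Then $f$ is integrable with respect to $\sigma^{\pm}$, the integral defining $U^\sigma$ converges absolutely at every point of $rS^d$, $D(f)\in L_p(rS^d)$, $U^\sigma\in L_{p'}(rS^d)$, and $$\left|\int_{S^d} f\,d\sigma\right|\le\frac1{r_0}\,\|D(f)\|_{L_p(rS^d)}\,\|U^\sigma\|_{L_{p'}(rS^d)},$$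 where the norms are taken with respect to $\mu_d$ on $rS^d$. -/

import Mathlib

open MeasureTheory Filter Topology
open scoped ENNReal

noncomputable section

/-- The ambient Euclidean space `ℝ^(d+1)`. -/
abbrev Amb (d : ℕ) : Type := EuclideanSpace ℝ (Fin (d + 1))

/-- The unit sphere `S^d` of `ℝ^(d+1)`. -/
abbrev USphere (d : ℕ) : Type := Metric.sphere (0 : Amb d) 1

/-- The surface measure `μ_d` on the unit sphere `S^d` (not normalized). -/
def surfaceMeasure (d : ℕ) : Measure (USphere d) :=
  (volume : Measure (Amb d)).toSphere

/-- The surface measure `μ_d` on the sphere `r S^d` of radius `r > 0`, as a measure on `ℝ^(d+1)`: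
the image of the surface measure of `S^d` under `η ↦ r η`, multiplied by `r ^ d`. -/
def sphereMeasure (d : ℕ) (r : ℝ) : Measure (Amb d) :=
  ENNReal.ofReal (r ^ d) • (surfaceMeasure d).map (fun η : USphere d => r • (η : Amb d))

/-- The surface area `ω_d = 2 π^((d+1)/2) / Γ((d+1)/2)` of `S^d`. -/
def sphereArea (d : ℕ) : ℝ :=
  2 * Real.pi ^ (((d : ℝ) + 1) / 2) / Real.Gamma (((d : ℝ) + 1) / 2)

/-! ### Spherical harmonics -/

/-- The formal Laplacian on real polynomials in `d + 1` variables. -/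
def polyLaplacian (d : ℕ) :
    MvPolynomial (Fin (d + 1)) ℝ →ₗ[ℝ] MvPolynomial (Fin (d + 1)) ℝ :=
  ∑ i : Fin (d + 1),
    (MvPolynomial.pderiv i).toLinearMap ∘ₗ (MvPolynomial.pderiv i).toLinearMap

/-- Restriction of a polynomial in `d + 1` variables to the sphere `S^d`. -/
def restrictToSphere (d : ℕ) : MvPolynomial (Fin (d + 1)) ℝ →ₗ[ℝ] (USphere d → ℝ) where
  toFun P := fun η => MvPolynomial.eval (fun i => (η : Amb d) i) P
  map_add' P Q := by ext η; simp
  map_smul' c P := by ext η; simp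

/-- The space of spherical harmonics of degree `l`: restrictions to `S^d` of the homogeneous
harmonic polynomials of degree `l`. -/
def sphericalHarmonics (d l : ℕ) : Submodule ℝ (USphere d → ℝ) :=
  (MvPolynomial.homogeneousSubmodule (Fin (d + 1)) ℝ l ⊓ LinearMap.ker (polyLaplacian d)).map
    (restrictToSphere d)

/-- `Z(d,l)`, the dimension of the space of spherical harmonics of degree `l`. -/
def harmonicDim (d l : ℕ) : ℕ := Module.finrank ℝ (sphericalHarmonics d l)

/-- `Y l k`, for `l ≥ 0` and `Z(d,l)` values of `k`, is a real orthonormal basis of `L²(S^d)`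
(with respect to the surface measure) in which `Y l k` is a spherical harmonic of degree `l`. -/
structure IsHarmonicBasis (d : ℕ) (Y : (l : ℕ) → Fin (harmonicDim d l) → USphere d → ℝ) :
    Prop where
  mem : ∀ l k, Y l k ∈ sphericalHarmonics d l
  basis : ∃ b : HilbertBasis (Σ l : ℕ, Fin (harmonicDim d l)) ℝ (Lp ℝ 2 (surfaceMeasure d)),
    ∀ l k, (b ⟨l, k⟩ : USphere d → ℝ) =ᵐ[surfaceMeasure d] Y l k

/-- The function `f_r` on `S^d` given by `f_r(η) = f(r η)`. -/
def scaled (d : ℕ) (r : ℝ) (f : Amb d → ℝ) : USphere d → ℝ := fun η => f (r • (η : Amb d))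

/-- The coefficient `∫_{S^d} g Y dμ_d`. -/
def harmonicCoeff (d : ℕ) (Y : USphere d → ℝ) (g : USphere d → ℝ) : ℝ :=
  ∫ η, g η * Y η ∂(surfaceMeasure d)

/-- Partial sum over the degrees `l < N` of the spherical harmonic expansion of `g` with the
degree-`l` part multiplied by `m l`. -/
def expansionSum (d : ℕ) (Y : (l : ℕ) → Fin (harmonicDim d l) → USphere d → ℝ)
    (m : ℕ → ℝ) (g : USphere d → ℝ) (N : ℕ) (η : USphere d) : ℝ :=
  ∑ l ∈ Finset.range N, ∑ k, m l * harmonicCoeff d (Y l k) g * Y l k η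

/-- `g` is recovered at every point of `S^d` by its spherical harmonic expansion. -/
def EqualsExpansion (d : ℕ) (Y : (l : ℕ) → Fin (harmonicDim d l) → USphere d → ℝ)
    (g : USphere d → ℝ) : Prop :=
  ∀ η, Tendsto (fun N => expansionSum d Y (fun _ => 1) g N η) atTop (𝓝 (g η))

/-- The symbol `(2 l + d - 1) / ((d - 1) ω_d)` of the operator `D`. -/
def symbolD (d l : ℕ) : ℝ := (2 * (l : ℝ) + d - 1) / (((d : ℝ) - 1) * sphereArea d)

/-- `h = D(g)`: the function `h` is the sum in `L²(S^d)` of the series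
`∑_{l,k} (2 l + d - 1) / ((d - 1) ω_d) ĝ(l,k) Y_{l,k}`. -/
def IsD (d : ℕ) (Y : (l : ℕ) → Fin (harmonicDim d l) → USphere d → ℝ)
    (g h : USphere d → ℝ) : Prop :=
  MemLp h 2 (surfaceMeasure d) ∧
    Tendsto (fun N => eLpNorm (fun η => h η - expansionSum d Y (symbolD d) g N η) 2
      (surfaceMeasure d)) atTop (𝓝 0)

/-! ### Signed measures and potentials -/

/-- A positive measure `ν` has finite (Newtonian) energy: `∬ ‖x - y‖^(1-d) dν(y) dν(x) < ∞`,
the kernel being `+∞` on the diagonal. -/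
def FiniteEnergy (d : ℕ) (ν : Measure (Amb d)) : Prop :=
  ∫⁻ x, ∫⁻ y, (ENNReal.ofReal (‖x - y‖ ^ (d - 1)))⁻¹ ∂ν ∂ν < ∞

/-- The class `M_d` of finite signed measures whose positive and negative parts are supported
on `S^d` and have finite energy. -/
structure IsAdmissible (d : ℕ) (σ : SignedMeasure (Amb d)) : Prop where
  supp_pos : σ.toJordanDecomposition.posPart (Metric.sphere 0 1)ᶜ = 0
  supp_neg : σ.toJordanDecomposition.negPart (Metric.sphere 0 1)ᶜ = 0
  energy_pos : FiniteEnergy d σ.toJordanDecomposition.posPart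
  energy_neg : FiniteEnergy d σ.toJordanDecomposition.negPart

/-- `∫ f dσ = ∫ f dσ⁺ - ∫ f dσ⁻` for a signed measure `σ`. -/
def signedIntegral (d : ℕ) (σ : SignedMeasure (Amb d)) (f : Amb d → ℝ) : ℝ :=
  (∫ x, f x ∂σ.toJordanDecomposition.posPart) - ∫ x, f x ∂σ.toJordanDecomposition.negPart

/-- `f` is integrable with respect to both parts of the signed measure `σ`. -/
def SignedIntegrable (d : ℕ) (σ : SignedMeasure (Amb d)) (f : Amb d → ℝ) : Prop :=
  Integrable f σ.toJordanDecomposition.posPart ∧ Integrable f σ.toJordanDecomposition.negPart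

/-- The Newtonian potential `U^σ(x) = ∫ ‖x - y‖^(1-d) dσ(y)`. -/
def newtonPotential (d : ℕ) (σ : SignedMeasure (Amb d)) (x : Amb d) : ℝ :=
  signedIntegral d σ (fun y => (‖x - y‖ ^ (d - 1))⁻¹)

end

/-! On `S^d` the function `f` is a single layer potential with density `D(f)`: `f(x) = r^(d-1) ∫ ‖x
- rη‖^(1-d) D(f_r)(η) dμ_d(η)`, which is `eq_single_layer`. Integrating this in `σ` and applying
Fubini gives `∫ f dσ = r⁻¹ ∫ D(f) U^σ dμ_d` over `rS^d`; Hölder and `1/r ≤ 1/r₀` finish the proof.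
The kernel is only integrated between the disjoint spheres `S^d` and `rS^d`, where it is bounded, so
every integral converges.

The representation is checked coefficient by coefficient, both sides being continuous on `S^d` and
the basis complete. On one side, the degree-`l` coefficients of `f` on `S^d` are `r^(l+d-1)` times
those of `f_r` (`integral_sphere_exterior`). On the other, integration of a degree-`l` harmonic
against `‖x - sη‖^(1-d)` multiplies it by `s^l / symbolD d l` (`integral_newtonKernel_mul_polyFun`):
the symbol of `D` inverts the eigenvalues of the single layer operator.

Both facts rest on one mechanism. The Green flux of a harmonic function against a homogeneous
harmonic polynomial is the same through all concentric spheres (`greenFlux_const`), so the moment of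
the function against that polynomial solves a first-order radial equation with solutions spanned by
`ρ^l` and `ρ^(-(l+d-1))`. Decay at infinity selects the second, regularity at the origin the first.
For the Newtonian kernel the remaining constant is found by applying `2s ∂_s + (d-1)`, which
produces the Poisson kernel, and letting `s → 1`. -/

open scoped Laplacian

/-! ### Green's identity in weak form. -/

/-- The `i`-th standard unit vector. -/
noncomputable abbrev stdVec {d : ℕ} (i : Fin (d + 1)) : Amb d := EuclideanSpace.single i (1 : ℝ)

theorem sum_smul_stdVec {d : ℕ} (x : Amb d) : ∑ i, x i • stdVec i = x := by
  have := (EuclideanSpace.basisFun (Fin (d + 1)) ℝ).sum_repr x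
  simpa using this

theorem laplacian_eq_sum_fderiv {d : ℕ} {f : Amb d → ℝ} {x : Amb d} (hf : ContDiffAt ℝ 2 f x) :
    Δ f x = ∑ i, fderiv ℝ (fun y => fderiv ℝ f y (stdVec i)) x (stdVec i) := by
  rw [InnerProductSpace.laplacian_eq_iteratedFDeriv_orthonormalBasis f
    (EuclideanSpace.basisFun (Fin (d + 1)) ℝ)]
  refine Finset.sum_congr rfl fun i _ => ?_
  rw [iteratedFDeriv_two_apply]
  have h : DifferentiableAt ℝ (fderiv ℝ f) x :=
    (hf.fderiv_right (m := 1) (by norm_num)).differentiableAt (by norm_num)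
  rw [fderiv_clm_apply h (differentiableAt_const _)]
  simp

/-- The field `f ∇g - g ∇f` is divergence free on `U`; this is that fact tested against `φ` through
integration by parts. Choosing `φ` radial later replaces a divergence theorem on shells. -/
theorem integral_green {d : ℕ} {U : Set (Amb d)} (hU : IsOpen U) {f g φ : Amb d → ℝ}
    (hf : InnerProductSpace.HarmonicOnNhd f U) (hg : InnerProductSpace.HarmonicOnNhd g U)
    (hφ : ContDiff ℝ 1 φ) (hφc : HasCompactSupport φ) (hφU : tsupport φ ⊆ U) :
    ∫ x, ∑ i, fderiv ℝ φ x (stdVec i) *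
      (f x * fderiv ℝ g x (stdVec i) - g x * fderiv ℝ f x (stdVec i)) = 0 := by
  have key : ∀ {f : Amb d → ℝ}, InnerProductSpace.HarmonicOnNhd f U → ∀ x ∈ U, ∀ v,
      ContDiffAt ℝ 1 (fun y => fderiv ℝ f y v) x := fun hf x hx v =>
    ((hf x hx).1.fderiv_right (m := 1) (by norm_num)).clm_apply contDiffAt_const
  set G : Fin (d + 1) → Amb d → ℝ := fun i x =>
    f x * fderiv ℝ g x (stdVec i) - g x * fderiv ℝ f x (stdVec i) with hG
  have hGd : ∀ i, ∀ x ∈ U, ContDiffAt ℝ 1 (G i) x := fun i x hx =>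
    (((hf x hx).1.of_le (by norm_num)).mul (key hg x hx _)).sub
      (((hg x hx).1.of_le (by norm_num)).mul (key hf x hx _))
  have hcont : ∀ {u v : Amb d → ℝ}, Continuous u → tsupport u ⊆ tsupport φ → ContinuousOn v U →
      Integrable (fun x => u x * v x) := by
    intro u v hu hsupp hv
    have hc : Continuous (fun x => u x * v x) :=
      (hu.continuousOn.mul hv).continuous_of_tsupport_subset hU
        ((tsupport_mul_subset_left).trans (hsupp.trans hφU))
    refine hc.integrable_of_hasCompactSupport ?_
    exact hφc.of_isClosed_subset (isClosed_tsupport _) (tsupport_mul_subset_left.trans hsupp)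
  have hfd : ∀ i, Continuous fun x => fderiv ℝ φ x (stdVec i) := fun i =>
    (hφ.continuous_fderiv (by norm_num)).clm_apply continuous_const
  have hsfd : ∀ i, tsupport (fun x => fderiv ℝ φ x (stdVec i)) ⊆ tsupport φ := fun i =>
    tsupport_fderiv_apply_subset ℝ _
  have hI1 : ∀ i, Integrable (fun x => fderiv ℝ φ x (stdVec i) * G i x) := fun i =>
    hcont (hfd i) (hsfd i) fun x hx => (hGd i x hx).continuousAt.continuousWithinAt
  have hfdG : ∀ i, ContinuousOn (fun x => fderiv ℝ (G i) x (stdVec i)) U := fun i x hx =>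
    (((hGd i x hx).fderiv_right (m := 0) (by norm_num)).continuousAt.clm_apply
      continuousAt_const).continuousWithinAt
  have hI2 : ∀ i, Integrable (fun x => φ x * fderiv ℝ (G i) x (stdVec i)) := fun i =>
    hcont hφ.continuous subset_rfl (hfdG i)
  have hI3 : ∀ i, Integrable (fun x => φ x * G i x) := fun i =>
    hcont hφ.continuous subset_rfl fun x hx => (hGd i x hx).continuousAt.continuousWithinAt
  have hparts : ∀ i, ∫ x, fderiv ℝ φ x (stdVec i) * G i x =
      - ∫ x, φ x * fderiv ℝ (G i) x (stdVec i) := fun i => by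
    rw [integral_mul_fderiv_eq_neg_fderiv_mul_of_integrable (hI1 i) (hI2 i) (hI3 i)
      (fun x _ => hφ.differentiable (by norm_num) x)
      (fun x hx => (hGd i x (hφU hx)).differentiableAt (by norm_num)), neg_neg]
  rw [integral_finsetSum _ fun i _ => hI1 i, Finset.sum_congr rfl fun i _ => hparts i,
    Finset.sum_neg_distrib, ← integral_finsetSum _ fun i _ => hI2 i, neg_eq_zero]
  refine integral_eq_zero_of_ae (Eventually.of_forall fun x => ?_)
  by_cases hx : x ∈ tsupport φ
  · have hxU := hφU hx
    -- The first-order cross terms `∇f · ∇g` cancel.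
    have hdiv : ∑ i, fderiv ℝ (G i) x (stdVec i) = f x * Δ g x - g x * Δ f x := by
      rw [laplacian_eq_sum_fderiv (hg x hxU).1, laplacian_eq_sum_fderiv (hf x hxU).1,
        Finset.mul_sum, Finset.mul_sum, ← Finset.sum_sub_distrib]
      refine Finset.sum_congr rfl fun i _ => ?_
      have hfx := ((hf x hxU).1.differentiableAt (by norm_num)).hasFDerivAt
      have hgx := ((hg x hxU).1.differentiableAt (by norm_num)).hasFDerivAt
      have hfi := ((key hf x hxU (stdVec i)).differentiableAt (by norm_num)).hasFDerivAt
      have hgi := ((key hg x hxU (stdVec i)).differentiableAt (by norm_num)).hasFDerivAt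
      have := ((hfx.mul hgi).sub (hgx.mul hfi)).fderiv
      simp only [hG]
      erw [this]
      simp only [sub_apply, add_apply,
        smul_apply, smul_eq_mul]
      ring
    simp only [Pi.zero_apply]
    rw [← Finset.mul_sum, hdiv, (hf x hxU).2.self_of_nhds, (hg x hxU).2.self_of_nhds]
    simp
  · simp [image_eq_zero_of_notMem_tsupport hx]

/-! ### Polar coordinates and the du Bois-Reymond lemma. -/

instance (d : ℕ) : IsFiniteMeasure (surfaceMeasure d) :=
  inferInstanceAs (IsFiniteMeasure (volume : Measure (Amb d)).toSphere)

instance (d : ℕ) : (surfaceMeasure d).IsOpenPosMeasure :=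
  inferInstanceAs ((volume : Measure (Amb d)).toSphere.IsOpenPosMeasure)

theorem integral_polar {d : ℕ} (F : Amb d → ℝ) (hF : Integrable F) :
    ∫ x, F x = ∫ ρ in Set.Ioi (0 : ℝ), ρ ^ d * ∫ η, F (ρ • (η : Amb d)) ∂(surfaceMeasure d) := by
  have hdim : Module.finrank ℝ (Amb d) - 1 = d := by simp
  have hmp := (volume : Measure (Amb d)).measurePreserving_homeomorphUnitSphereProd
  rw [hdim] at hmp
  have he := (Homeomorph.measurableEmbedding (homeomorphUnitSphereProd (Amb d)))
  set g : USphere d × Set.Ioi (0 : ℝ) → ℝ := fun p => F ((p.2 : ℝ) • (p.1 : Amb d)) with hg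
  have hcomp : ∀ x : ({0}ᶜ : Set (Amb d)), g (homeomorphUnitSphereProd (Amb d) x) = F x := by
    intro x
    have := congrArg Subtype.val ((homeomorphUnitSphereProd (Amb d)).symm_apply_apply x)
    simp only [hg]
    rw [homeomorphUnitSphereProd_symm_apply_coe] at this
    rw [this]
  have hFi : Integrable (fun x : ({0}ᶜ : Set (Amb d)) => F x.1)
      (volume.comap Subtype.val) := by
    have := (integrableOn_iff_comap_subtypeVal (μ := volume) (f := F)
      (measurableSet_singleton (0 : Amb d)).compl).1 hF.integrableOn
    exact this
  have hgi : Integrable g ((surfaceMeasure d).prod (.volumeIoiPow d)) := by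
    rw [surfaceMeasure, ← hmp.integrable_comp_emb he]
    refine hFi.congr (Eventually.of_forall fun x => (hcomp x).symm)
  calc ∫ x, F x = ∫ x : ({0}ᶜ : Set (Amb d)), F x ∂(volume.comap Subtype.val) := by
        rw [integral_subtype_comap (measurableSet_singleton _).compl, restrict_compl_singleton]
    _ = ∫ x : ({0}ᶜ : Set (Amb d)), g (homeomorphUnitSphereProd (Amb d) x)
          ∂(volume.comap Subtype.val) := by simp_rw [hcomp]
    _ = ∫ p, g p ∂((surfaceMeasure d).prod (.volumeIoiPow d)) := hmp.integral_comp he g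
    _ = ∫ ρ, ∫ η, g (η, ρ) ∂(surfaceMeasure d) ∂(.volumeIoiPow d) := integral_prod_symm g hgi
    _ = _ := by
        rw [Measure.volumeIoiPow, integral_withDensity_eq_integral_toReal_smul
          (by fun_prop) (by simp)]
        rw [← integral_subtype_comap measurableSet_Ioi
          (fun ρ : ℝ => ρ ^ d * ∫ η, F (ρ • (η : Amb d)) ∂(surfaceMeasure d))]
        refine integral_congr_ae (Eventually.of_forall fun ρ => ?_)
        have : (0 : ℝ) ≤ (ρ : ℝ) ^ d := pow_nonneg (le_of_lt ρ.2) _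
        simp [hg, ENNReal.toReal_ofReal this]

/-- A continuous function annihilating the derivatives of all compactly supported test functions
is constant. -/
theorem eq_of_forall_integral_deriv_mul_eq_zero {a b : ℝ} {M : ℝ → ℝ}
    (hM : ContinuousOn M (Set.Ioo a b))
    (h : ∀ ψ : ℝ → ℝ, ContDiff ℝ 1 ψ → HasCompactSupport ψ → tsupport ψ ⊆ Set.Ioo a b →
      ∫ t, deriv ψ t * M t = 0)
    {s t : ℝ} (hs : s ∈ Set.Ioo a b) (ht : t ∈ Set.Ioo a b) : M s = M t := by
  have near : ∀ c ∈ Set.Ioo a b, ∀ ε > 0, ∃ B : ContDiffBump c,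
      Metric.closedBall c B.rOut ⊆ Set.Ioo a b ∧
      Integrable (fun t => B.normed volume t * M t) ∧
      |(∫ t, B.normed volume t * M t) - M c| ≤ ε := by
    intro c hc ε hε
    have h1 : ∀ᶠ t in 𝓝 c, t ∈ Set.Ioo a b := isOpen_Ioo.mem_nhds hc
    have h2 : ∀ᶠ t in 𝓝 c, |M t - M c| < ε := by
      have := Metric.continuousAt_iff'.1 (hM.continuousAt (isOpen_Ioo.mem_nhds hc)) ε hε
      simpa [Real.dist_eq] using this
    obtain ⟨δ, hδ, hball⟩ := Metric.eventually_nhds_iff_ball.1 (h1.and h2)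
    let B : ContDiffBump c := ⟨δ / 4, δ / 2, by positivity, by linarith⟩
    have hsub : Metric.closedBall c B.rOut ⊆ Metric.ball c δ :=
      Metric.closedBall_subset_ball (by change δ / 2 < δ; linarith)
    have hts : tsupport (B.normed volume) ⊆ Set.Ioo a b := by
      rw [B.tsupport_normed_eq]
      exact fun t ht => (hball t (hsub ht)).1
    have hint : Integrable (fun t => B.normed volume t * M t) := by
      refine Continuous.integrable_of_hasCompactSupport ?_ B.hasCompactSupport_normed.mul_right
      exact (B.continuous_normed.continuousOn.mul hM).continuous_of_tsupport_subset isOpen_Ioo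
        (tsupport_mul_subset_left.trans hts)
    refine ⟨B, fun t ht => (hball t (hsub ht)).1, hint, ?_⟩
    have hc1 : (∫ t, B.normed volume t * M t) - M c = ∫ t, B.normed volume t * (M t - M c) := by
      simp_rw [mul_sub]
      rw [integral_sub hint (B.integrable_normed.mul_const _), integral_mul_const,
        B.integral_normed, one_mul]
    rw [hc1, ← Real.norm_eq_abs]
    calc _ ≤ ∫ t, B.normed volume t * ε := by
          refine norm_integral_le_of_norm_le (B.integrable_normed.mul_const _)
            (Eventually.of_forall fun t => ?_)
          rw [norm_mul, Real.norm_of_nonneg (B.nonneg_normed t)]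
          by_cases ht : t ∈ Metric.ball c δ
          · exact mul_le_mul_of_nonneg_left (hball t ht).2.le (B.nonneg_normed t)
          · have : B.normed volume t = 0 := by
              by_contra hne
              have : t ∈ Function.support (B.normed volume) := hne
              rw [B.support_normed_eq] at this
              exact ht (hsub (Metric.ball_subset_closedBall this))
            simp [this]
      _ = ε := by rw [integral_mul_const, B.integral_normed, one_mul]
  refine eq_of_forall_dist_le fun ε hε => ?_
  obtain ⟨B, hB, hBi, hBe⟩ := near s hs (ε / 2) (by positivity)
  obtain ⟨C, hC, hCi, hCe⟩ := near t ht (ε / 2) (by positivity)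
  -- `β` has total mass zero, so its primitive `ψ` is compactly supported and an admissible test
  -- function with `ψ' = β`. The hypothesis then equates the averages of `M` near `s` and near `t`.
  set β : ℝ → ℝ := fun u => B.normed volume u - C.normed volume u with hβ
  have hβc : Continuous β := B.continuous_normed.sub C.continuous_normed
  set α : ℝ := min (s - B.rOut) (t - C.rOut) with hα
  set γ : ℝ := max (s + B.rOut) (t + C.rOut) with hγ
  have hB1 : s - B.rOut ∈ Set.Ioo a b := hB (by simp [abs_of_pos B.rOut_pos])
  have hB2 : s + B.rOut ∈ Set.Ioo a b := hB (by simp [abs_of_pos B.rOut_pos])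
  have hC1 : t - C.rOut ∈ Set.Ioo a b := hC (by simp [abs_of_pos C.rOut_pos])
  have hC2 : t + C.rOut ∈ Set.Ioo a b := hC (by simp [abs_of_pos C.rOut_pos])
  have hβ0 : ∀ u, u ∉ Set.Icc α γ → β u = 0 := by
    intro u hu
    have h1 : B.normed volume u = 0 := by
      by_contra hne
      have : u ∈ Function.support (B.normed volume) := hne
      rw [B.support_normed_eq, Real.ball_eq_Ioo] at this
      exact hu ⟨(min_le_left _ _).trans this.1.le, this.2.le.trans (le_max_left _ _)⟩
    have h2 : C.normed volume u = 0 := by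
      by_contra hne
      have : u ∈ Function.support (C.normed volume) := hne
      rw [C.support_normed_eq, Real.ball_eq_Ioo] at this
      exact hu ⟨(min_le_right _ _).trans this.1.le, this.2.le.trans (le_max_right _ _)⟩
    simp [hβ, h1, h2]
  have hβi : Integrable β := B.integrable_normed.sub C.integrable_normed
  have hαγ : α ≤ γ := (min_le_left _ _).trans
    ((by linarith [B.rOut_pos] : s - B.rOut ≤ s + B.rOut).trans (le_max_left _ _))
  have htot : ∀ v, γ ≤ v → ∫ u in α..v, β u = 0 := by
    intro v hv
    have : ∫ u, β u = 0 := by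
      rw [hβ, integral_sub B.integrable_normed C.integrable_normed, B.integral_normed,
        C.integral_normed, sub_self]
    rw [intervalIntegral.integral_of_le (hαγ.trans hv), ← integral_Icc_eq_integral_Ioc,
      setIntegral_eq_integral_of_forall_compl_eq_zero, this]
    exact fun u hu => hβ0 u fun h => hu ⟨h.1, h.2.trans hv⟩
  set ψ : ℝ → ℝ := fun v => ∫ u in α..v, β u with hψ
  have hderiv : ∀ v, HasDerivAt ψ (β v) v := fun v =>
    intervalIntegral.integral_hasDerivAt_right (hβc.intervalIntegrable _ _)
      (hβc.stronglyMeasurableAtFilter _ _) hβc.continuousAt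
  have hd : deriv ψ = β := funext fun v => (hderiv v).deriv
  have hψc : ContDiff ℝ 1 ψ := by
    rw [contDiff_one_iff_deriv, hd]
    exact ⟨fun v => (hderiv v).differentiableAt, hβc⟩
  have hψs : Function.support ψ ⊆ Set.Icc α γ := by
    intro v hv
    by_contra hne
    refine hv ?_
    by_cases hva : α ≤ v
    · exact htot v (le_of_not_ge fun h => hne ⟨hva, h⟩)
    · push Not at hva
      refine intervalIntegral.integral_zero_ae (Eventually.of_forall fun u hu => ?_)
      rw [Set.uIoc_of_ge hva.le] at hu
      rcases hu.2.lt_or_eq with h | h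
      · exact hβ0 u fun h' => absurd h'.1 (not_le.2 h)
      -- The half-open interval `(v, α]` contains the endpoint `α`, where `hβ0` says nothing; `β α =
      -- 0` follows by continuity from the left.
      · have : Tendsto β (𝓝[<] α) (𝓝 (β α)) := hβc.continuousAt.continuousWithinAt
        have h0 : Tendsto β (𝓝[<] α) (𝓝 0) := by
          refine tendsto_const_nhds.congr' ?_
          filter_upwards [self_mem_nhdsWithin] with w hw
          exact (hβ0 w fun h' => absurd h'.1 (not_le.2 hw)).symm
        rw [h]
        exact tendsto_nhds_unique this h0
  have hψt : tsupport ψ ⊆ Set.Icc α γ := closure_minimal hψs isClosed_Icc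
  have hsub : Set.Icc α γ ⊆ Set.Ioo a b := fun v hv =>
    ⟨(lt_min hB1.1 hC1.1).trans_le hv.1, hv.2.trans_lt (max_lt hB2.2 hC2.2)⟩
  have h0 := h ψ hψc (HasCompactSupport.of_support_subset_isCompact isCompact_Icc hψs)
    (hψt.trans hsub)
  rw [hd] at h0
  simp only [hβ, sub_mul] at h0
  rw [integral_sub hBi hCi] at h0
  rw [abs_le] at hBe hCe
  rw [Real.dist_eq, abs_le]
  constructor <;> linarith [hBe.1, hBe.2, hCe.1, hCe.2]

theorem hasFDerivAt_norm_of_ne_zero {E : Type*} [NormedAddCommGroup E] [InnerProductSpace ℝ E]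
    {x : E} (hx : x ≠ 0) : HasFDerivAt (fun y : E => ‖y‖) (‖x‖⁻¹ • innerSL ℝ x) x := by
  have h := (hasStrictFDerivAt_norm_sq x).hasFDerivAt.sqrt (by simpa using hx)
  simp only [Real.sqrt_sq (norm_nonneg _)] at h
  convert h using 1
  ext v
  simp
  field_simp

/-! ### Constancy of the Green flux through concentric spheres. -/

/-- The flux of `f ∇g - g ∇f` through the sphere of radius `ρ`. -/
noncomputable def greenFlux (d : ℕ) (f g : Amb d → ℝ) (ρ : ℝ) : ℝ :=
  ρ ^ d * ∫ η : USphere d, (f (ρ • (η : Amb d)) * fderiv ℝ g (ρ • (η : Amb d)) η -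
    g (ρ • (η : Amb d)) * fderiv ℝ f (ρ • (η : Amb d)) η) ∂(surfaceMeasure d)

/-- The open spherical shell around the origin. -/
def shell (d : ℕ) (a b : ℝ) : Set (Amb d) := {x | a < ‖x‖ ∧ ‖x‖ < b}

theorem isOpen_shell {d : ℕ} {a b : ℝ} : IsOpen (shell d a b) :=
  (isOpen_lt continuous_const continuous_norm).inter (isOpen_lt continuous_norm continuous_const)

theorem smul_mem_shell {d : ℕ} {a b ρ : ℝ} (ha : 0 ≤ a) (hρ : ρ ∈ Set.Ioo a b) (η : USphere d) :
    ρ • (η : Amb d) ∈ shell d a b := by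
  have : ‖ρ • (η : Amb d)‖ = ρ := by
    rw [norm_smul, norm_eq_of_mem_sphere, mul_one, Real.norm_of_nonneg (ha.trans hρ.1.le)]
  exact ⟨this.symm ▸ hρ.1, this.symm ▸ hρ.2⟩

/-- Continuity in the radius of integrals over concentric spheres. -/
theorem continuousOn_integral_sphere {d : ℕ} {s : Set ℝ}
    {F : ℝ → USphere d → ℝ} (hF : ContinuousOn (Function.uncurry F) (s ×ˢ Set.univ)) :
    ContinuousOn (fun ρ => ∫ η, F ρ η ∂(surfaceMeasure d)) s := by
  have := continuousOn_integral_of_compact_support (μ := surfaceMeasure d) (k := Set.univ)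
    (f := F) (s := s) isCompact_univ hF (fun p x _ hx => absurd (Set.mem_univ x) hx)
  exact this

/-- For radial `φ(x) = ψ(‖x‖)`, polar coordinates turn `integral_green` into `∫ ψ' · flux = 0` for
every test function `ψ` on `(a, b)`, which forces the continuous flux to be constant. -/
theorem greenFlux_const {d : ℕ} {a b : ℝ} (ha : 0 ≤ a) {f g : Amb d → ℝ}
    (hf : InnerProductSpace.HarmonicOnNhd f (shell d a b))
    (hg : InnerProductSpace.HarmonicOnNhd g (shell d a b))
    {s t : ℝ} (hs : s ∈ Set.Ioo a b) (ht : t ∈ Set.Ioo a b) :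
    greenFlux d f g s = greenFlux d f g t := by
  have hcf : ∀ {f : Amb d → ℝ}, InnerProductSpace.HarmonicOnNhd f (shell d a b) →
      ContinuousOn (fun p : ℝ × USphere d => f (p.1 • (p.2 : Amb d)))
        (Set.Ioo a b ×ˢ Set.univ) := fun hf =>
    hf.contDiffOn.continuousOn.comp (by fun_prop) fun p hp => smul_mem_shell ha hp.1 p.2
  have hcd : ∀ {f : Amb d → ℝ}, InnerProductSpace.HarmonicOnNhd f (shell d a b) →
      ContinuousOn (fun p : ℝ × USphere d => fderiv ℝ f (p.1 • (p.2 : Amb d)) p.2)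
        (Set.Ioo a b ×ˢ Set.univ) := fun {f} hf => by
    refine ContinuousOn.clm_apply (f := fun p : ℝ × USphere d => fderiv ℝ f (p.1 • (p.2 : Amb d)))
      (g := fun p : ℝ × USphere d => (p.2 : Amb d)) ?_ (by fun_prop)
    exact (hf.contDiffOn.continuousOn_fderiv_of_isOpen isOpen_shell (by norm_num)).comp
      (by fun_prop) fun p hp => smul_mem_shell ha hp.1 p.2
  refine eq_of_forall_integral_deriv_mul_eq_zero (a := a) (b := b) ?_ ?_ hs ht
  · refine (continuousOn_id.pow d).mul (continuousOn_integral_sphere ?_)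
    exact ((hcf hf).mul (hcd hg)).sub ((hcf hg).mul (hcd hf))
  · intro ψ hψ hψc hψs
    set φ : Amb d → ℝ := fun x => ψ ‖x‖ with hφ
    have hφs : Function.support φ ⊆ {x | ‖x‖ ∈ tsupport ψ} := fun x hx => subset_tsupport ψ hx
    have hcl : IsClosed {x : Amb d | ‖x‖ ∈ tsupport ψ} :=
      (isClosed_tsupport ψ).preimage continuous_norm
    have hφt : tsupport φ ⊆ {x | ‖x‖ ∈ tsupport ψ} := closure_minimal hφs hcl
    have hφU : tsupport φ ⊆ shell d a b := fun x hx => hψs (hφt hx)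
    have hφc : HasCompactSupport φ :=
      (isCompact_closedBall (0 : Amb d) b).of_isClosed_subset (isClosed_tsupport _) fun x hx => by
        simpa using (hφU hx).2.le
    have h0 : ∀ x : Amb d, x ∉ shell d a b → φ =ᶠ[𝓝 x] 0 := fun x hx =>
      notMem_tsupport_iff_eventuallyEq.1 fun h => hx (hφU h)
    -- Since `0 ≤ a`, the shell avoids the origin, the only point where the norm fails to be smooth;
    -- off the shell `φ` vanishes locally.
    have hφd : ContDiff ℝ 1 φ := by
      rw [contDiff_iff_contDiffAt]
      intro x
      by_cases hx : x ∈ shell d a b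
      · have : x ≠ 0 := norm_pos_iff.1 (ha.trans_lt hx.1)
        exact hψ.contDiffAt.comp x (contDiffAt_norm ℝ this)
      · exact contDiffAt_const.congr_of_eventuallyEq (h0 x hx)
    have hφ' : ∀ x v, fderiv ℝ φ x v = deriv ψ ‖x‖ * (inner ℝ x v / ‖x‖) := by
      intro x v
      by_cases hx : x ∈ shell d a b
      · have hx0 : x ≠ 0 := norm_pos_iff.1 (ha.trans_lt hx.1)
        have h1 : HasDerivAt ψ (deriv ψ ‖x‖) ‖x‖ :=
          (hψ.differentiable (by norm_num) _).hasDerivAt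
        have h2 : HasFDerivAt φ _ x := h1.comp_hasFDerivAt x (hasFDerivAt_norm_of_ne_zero hx0)
        rw [h2.fderiv]
        simp [div_eq_inv_mul]
      · have : deriv ψ ‖x‖ = 0 := by
          have : ‖x‖ ∉ tsupport ψ := fun h => hx (hψs h)
          exact image_eq_zero_of_notMem_tsupport fun h => this (tsupport_deriv_subset h)
        rw [(h0 x hx).fderiv_eq, this]
        simp
    have hz := integral_green isOpen_shell hf hg hφd hφc hφU
    have hsum : ∀ x, ∑ i, fderiv ℝ φ x (stdVec i) *
        (f x * fderiv ℝ g x (stdVec i) - g x * fderiv ℝ f x (stdVec i)) =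
        deriv ψ ‖x‖ * (‖x‖⁻¹ * (f x * fderiv ℝ g x x - g x * fderiv ℝ f x x)) := by
      intro x
      have hexp : ∀ u : Amb d → ℝ, fderiv ℝ u x x = ∑ i, x i * fderiv ℝ u x (stdVec i) := by
        intro u
        conv_lhs => rw [← sum_smul_stdVec x, map_sum]
        simp [sum_smul_stdVec]
      rw [hexp f, hexp g, Finset.mul_sum, Finset.mul_sum, ← Finset.sum_sub_distrib,
        Finset.mul_sum, Finset.mul_sum]
      refine Finset.sum_congr rfl fun i _ => ?_
      rw [hφ']
      simp only [stdVec, EuclideanSpace.inner_single_right]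
      simp
      ring
    simp_rw [hsum] at hz
    rw [integral_polar] at hz
    · have hIoi : ∫ t, deriv ψ t * greenFlux d f g t =
          ∫ t in Set.Ioi (0 : ℝ), deriv ψ t * greenFlux d f g t := by
        refine (setIntegral_eq_integral_of_forall_compl_eq_zero fun t ht => ?_).symm
        have : t ∉ tsupport ψ := fun h => ht (ha.trans_lt (hψs h).1)
        rw [image_eq_zero_of_notMem_tsupport fun h => this (tsupport_deriv_subset h), zero_mul]
      rw [hIoi]
      refine Eq.trans ?_ hz
      refine setIntegral_congr_fun (s := Set.Ioi (0 : ℝ)) measurableSet_Ioi fun ρ hρ => ?_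
      have hρ : 0 < ρ := hρ
      have hn : ∀ η : USphere d, ‖ρ • (η : Amb d)‖ = ρ := fun η => by
        rw [norm_smul, norm_eq_of_mem_sphere, mul_one, Real.norm_of_nonneg hρ.le]
      simp only [hn, greenFlux, map_smul, smul_eq_mul]
      rw [integral_const_mul, mul_left_comm]
      congr 2
      refine integral_congr_ae (Eventually.of_forall fun η => ?_)
      simp only
      field_simp
    · have hsupp : tsupport (fun x : Amb d => deriv ψ ‖x‖ * (‖x‖⁻¹ * (f x * fderiv ℝ g x x -
          g x * fderiv ℝ f x x))) ⊆ {x | ‖x‖ ∈ tsupport ψ} := by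
        refine closure_minimal (fun x hx => ?_) hcl
        by_contra hne
        refine hx ?_
        have : deriv ψ ‖x‖ = 0 :=
          image_eq_zero_of_notMem_tsupport fun h => hne (tsupport_deriv_subset h)
        simp [this]
      refine Continuous.integrable_of_hasCompactSupport ?_ ?_
      · refine ContinuousOn.continuous_of_tsupport_subset (s := shell d a b) ?_ isOpen_shell
          (hsupp.trans fun x hx => hψs hx)
        have hfd : ∀ {f : Amb d → ℝ}, InnerProductSpace.HarmonicOnNhd f (shell d a b) →
            ContinuousOn (fun x => fderiv ℝ f x x) (shell d a b) := fun hf =>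
          (hf.contDiffOn.continuousOn_fderiv_of_isOpen isOpen_shell (by norm_num)).clm_apply
            continuousOn_id
        refine ((hψ.continuous_deriv (by norm_num)).comp continuous_norm).continuousOn.mul
          (ContinuousOn.mul ?_ ((hf.contDiffOn.continuousOn.mul (hfd hg)).sub
            (hg.contDiffOn.continuousOn.mul (hfd hf))))
        exact continuousOn_id.norm.inv₀ fun x hx => (ha.trans_lt hx.1).ne'
      · exact (isCompact_closedBall (0 : Amb d) b).of_isClosed_subset (isClosed_tsupport _)
          fun x hx => by simpa using (hψs (hsupp hx)).2.le

/-! ### Homogeneous harmonic polynomials as functions. -/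

/-- The polynomial function on `ℝ^(d+1)` attached to a polynomial. -/
noncomputable def polyFun {d : ℕ} (P : MvPolynomial (Fin (d + 1)) ℝ) (x : Amb d) : ℝ :=
  MvPolynomial.eval (fun i => x i) P

theorem polyFun_contDiff {d : ℕ} (P : MvPolynomial (Fin (d + 1)) ℝ) {n : WithTop ℕ∞} :
    ContDiff ℝ n (polyFun P) := by
  induction P using MvPolynomial.induction_on with
  | C a =>
    have : polyFun (d := d) (MvPolynomial.C a) = fun _ => a := by ext x; simp [polyFun]
    rw [this]; exact contDiff_const
  | add p q hp hq =>
    have : polyFun (d := d) (p + q) = fun x => polyFun p x + polyFun q x := by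
      ext x; simp [polyFun]
    rw [this]; exact hp.add hq
  | mul_X p i hp =>
    have : polyFun (d := d) (p * MvPolynomial.X i) = fun x => polyFun p x * x i := by
      ext x; simp [polyFun]
    rw [this]
    exact hp.mul (EuclideanSpace.proj i : Amb d →L[ℝ] ℝ).contDiff

theorem fderiv_polyFun {d : ℕ} (P : MvPolynomial (Fin (d + 1)) ℝ) (x v : Amb d) :
    fderiv ℝ (polyFun P) x v = ∑ i, v i * polyFun (MvPolynomial.pderiv i P) x := by
  have hd : ∀ P : MvPolynomial (Fin (d + 1)) ℝ, DifferentiableAt ℝ (polyFun P) x := fun P =>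
    (polyFun_contDiff P (n := 1)).differentiable (by norm_num) x
  induction P using MvPolynomial.induction_on with
  | C a =>
    have : polyFun (d := d) (MvPolynomial.C a) = fun _ => a := by ext x; simp [polyFun]
    rw [this]; simp [polyFun]
  | add p q hp hq =>
    have : polyFun (d := d) (p + q) = fun x => polyFun p x + polyFun q x := by
      ext x; simp [polyFun]
    rw [this, fderiv_fun_add (hd p) (hd q)]
    simp only [add_apply, hp, hq, ← Finset.sum_add_distrib]
    refine Finset.sum_congr rfl fun i _ => ?_
    simp [polyFun, mul_add]
  | mul_X p i hp =>
    have : polyFun (d := d) (p * MvPolynomial.X i) =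
        fun x => polyFun p x * (EuclideanSpace.proj i : Amb d →L[ℝ] ℝ) x := by
      ext x; simp [polyFun]
    have hX : HasFDerivAt (fun x : Amb d => (EuclideanSpace.proj i : Amb d →L[ℝ] ℝ) x)
      (EuclideanSpace.proj i : Amb d →L[ℝ] ℝ) x := ContinuousLinearMap.hasFDerivAt _
    have hm : HasFDerivAt (fun x => polyFun p x * (EuclideanSpace.proj i : Amb d →L[ℝ] ℝ) x) _ x :=
      (hd p).hasFDerivAt.mul hX
    rw [this, hm.fderiv]
    simp only [add_apply, smul_apply, hp, smul_eq_mul, PiLp.proj_apply]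
    have : ∀ j, v j * polyFun (MvPolynomial.pderiv j (p * MvPolynomial.X i)) x =
        (if j = i then v j * polyFun p x else 0) +
        x i * (v j * polyFun (MvPolynomial.pderiv j p) x) := by
      intro j
      by_cases h : j = i
      · subst h; simp [polyFun]; ring
      · simp [polyFun, MvPolynomial.pderiv_X_of_ne (Ne.symm h), h]; ring
    simp only [this, Finset.sum_add_distrib, Finset.sum_ite_eq', Finset.mem_univ, if_true,
      ← Finset.mul_sum]
    ring

theorem harmonic_polyFun {d : ℕ} {P : MvPolynomial (Fin (d + 1)) ℝ}
    (hP : polyLaplacian d P = 0) (s : Set (Amb d)) :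
    InnerProductSpace.HarmonicOnNhd (polyFun P) s := by
  refine fun x _ => ⟨(polyFun_contDiff P).contDiffAt, Eventually.of_forall fun y => ?_⟩
  rw [laplacian_eq_sum_fderiv (polyFun_contDiff P).contDiffAt]
  have h1 : ∀ (Q : MvPolynomial (Fin (d + 1)) ℝ) (y : Amb d) (i : Fin (d + 1)),
      fderiv ℝ (polyFun Q) y (stdVec i) = polyFun (MvPolynomial.pderiv i Q) y := by
    intro Q y i
    rw [fderiv_polyFun, Finset.sum_eq_single i]
    · simp
    · intro j _ hj; simp [hj]
    · simp
  simp only [h1]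
  have := congrArg (fun Q => polyFun Q y) hP
  simpa [polyLaplacian, polyFun] using this

/-- Euler's identity for homogeneous polynomials. -/
theorem fderiv_polyFun_self {d l : ℕ} {P : MvPolynomial (Fin (d + 1)) ℝ}
    (hP : P.IsHomogeneous l) (x : Amb d) :
    fderiv ℝ (polyFun P) x x = l * polyFun P x := by
  rw [fderiv_polyFun]
  have := congrArg (fun Q => polyFun Q x) hP.sum_X_mul_pderiv
  simpa [polyFun] using this

theorem polyFun_smul {d l : ℕ} {P : MvPolynomial (Fin (d + 1)) ℝ}
    (hP : P.IsHomogeneous l) (c : ℝ) (x : Amb d) :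
    polyFun P (c • x) = c ^ l * polyFun P x := by
  rw [polyFun, polyFun, MvPolynomial.eval_eq', MvPolynomial.eval_eq', Finset.mul_sum]
  refine Finset.sum_congr rfl fun m hm => ?_
  have hdeg : ∑ i, m i = l := by
    have := hP (MvPolynomial.mem_support_iff.1 hm)
    simpa [Finsupp.weight_apply, Finsupp.sum_fintype] using this
  simp only [PiLp.smul_apply, smul_eq_mul, mul_pow, Finset.prod_mul_distrib,
    Finset.prod_pow_eq_pow_sum, hdeg]
  ring

/-! ### The radial equation for moments of harmonic functions. -/

/-- Differentiation under the integral over the sphere. -/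
theorem hasDerivAt_integral_sphere {d : ℕ} {a b : ℝ} {F F' : ℝ → USphere d → ℝ}
    (hF : ∀ ρ ∈ Set.Ioo a b, Continuous (F ρ))
    (hF' : ContinuousOn (Function.uncurry F') (Set.Ioo a b ×ˢ Set.univ))
    (hd : ∀ ρ ∈ Set.Ioo a b, ∀ η, HasDerivAt (fun t => F t η) (F' ρ η) ρ)
    {ρ : ℝ} (hρ : ρ ∈ Set.Ioo a b) :
    HasDerivAt (fun t => ∫ η, F t η ∂(surfaceMeasure d)) (∫ η, F' ρ η ∂(surfaceMeasure d)) ρ := by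
  obtain ⟨δ, hδ, hball⟩ := Metric.nhds_basis_closedBall.mem_iff.1 (isOpen_Ioo.mem_nhds hρ)
  have hK : IsCompact (Metric.closedBall ρ δ ×ˢ (Set.univ : Set (USphere d))) :=
    (isCompact_closedBall ρ δ).prod isCompact_univ
  obtain ⟨C, hC⟩ := hK.exists_bound_of_continuousOn (hF'.mono (Set.prod_mono hball subset_rfl))
  have hi : ∀ {u : USphere d → ℝ}, Continuous u → Integrable u (surfaceMeasure d) := fun hu =>
    hu.integrable_of_hasCompactSupport (HasCompactSupport.of_compactSpace _)
  have hF'c : ∀ t ∈ Set.Ioo a b, Continuous (F' t) := fun t ht =>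
    hF'.comp_continuous (f := fun η : USphere d => (t, η)) (by fun_prop) fun η => ⟨ht, trivial⟩
  refine (hasDerivAt_integral_of_dominated_loc_of_deriv_le (F := F) (F' := F')
    (bound := fun _ => C) (Metric.closedBall_mem_nhds ρ hδ) ?_ (hi (hF ρ hρ))
    (hF'c ρ hρ).aestronglyMeasurable ?_ (integrable_const _) ?_).2
  · filter_upwards [isOpen_Ioo.mem_nhds hρ] with t ht using (hF t ht).aestronglyMeasurable
  · exact Eventually.of_forall fun η t ht => hC (t, η) ⟨ht, trivial⟩
  · exact Eventually.of_forall fun η t ht => hd t (hball ht) η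

section
variable {d l : ℕ} {f : Amb d → ℝ} {a b : ℝ} {P : MvPolynomial (Fin (d + 1)) ℝ}

/-- The derivative of spherical means of `f` against a polynomial, in terms of the radius. -/
theorem hasDerivAt_integral_mul_polyFun (ha : 0 ≤ a)
    (hf : ContDiffOn ℝ 1 f (shell d a b)) {ρ : ℝ} (hρ : ρ ∈ Set.Ioo a b) :
    HasDerivAt (fun t => ∫ η : USphere d, f (t • (η : Amb d)) * polyFun P η ∂(surfaceMeasure d))
      (∫ η : USphere d, fderiv ℝ f (ρ • (η : Amb d)) η * polyFun P η ∂(surfaceMeasure d)) ρ := by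
  have hP : Continuous fun η : USphere d => polyFun P (η : Amb d) :=
    (polyFun_contDiff P (n := 0)).continuous.comp continuous_subtype_val
  refine hasDerivAt_integral_sphere (a := a) (b := b)
    (F := fun t (η : USphere d) => f (t • (η : Amb d)) * polyFun P η)
    (F' := fun t (η : USphere d) => fderiv ℝ f (t • (η : Amb d)) η * polyFun P η) ?_ ?_ ?_ hρ
  · intro t ht
    refine Continuous.mul ?_ hP
    exact hf.continuousOn.comp_continuous (by fun_prop) fun η => smul_mem_shell ha ht η
  · refine ContinuousOn.mul ?_ (hP.comp continuous_snd).continuousOn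
    refine ContinuousOn.clm_apply (f := fun p : ℝ × USphere d => fderiv ℝ f (p.1 • (p.2 : Amb d)))
      (g := fun p : ℝ × USphere d => (p.2 : Amb d)) ?_ (by fun_prop)
    exact (hf.continuousOn_fderiv_of_isOpen isOpen_shell (by norm_num)).comp
      (by fun_prop) fun p hp => smul_mem_shell ha hp.1 p.2
  · intro t ht η
    refine HasDerivAt.mul_const ?_ _
    have h1 : HasFDerivAt f (fderiv ℝ f (t • (η : Amb d))) (t • (η : Amb d)) :=
      ((hf.contDiffAt (isOpen_shell.mem_nhds (smul_mem_shell ha ht η))).differentiableAt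
        (by norm_num)).hasFDerivAt
    have h2 : HasDerivAt (fun s : ℝ => s • (η : Amb d)) (η : Amb d) t := by
      simpa using (hasDerivAt_id t).smul_const (η : Amb d)
    exact h1.comp_hasDerivAt t h2

/-- Euler's identity removes the derivative of `P`, so constancy of the flux becomes a first-order
equation for the moment of `f` against `P`. The extra factor `ρ` avoids the exponent `l - 1`. -/
theorem greenFlux_polyFun (ha : 0 ≤ a) (hf : ContDiffOn ℝ 1 f (shell d a b))
    (hP : P.IsHomogeneous l) {ρ : ℝ} (hρ : ρ ∈ Set.Ioo a b) :
    ρ * greenFlux d f (polyFun P) ρ = ρ ^ (d + l) *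
      (l * (∫ η : USphere d, f (ρ • (η : Amb d)) * polyFun P η ∂(surfaceMeasure d)) -
      ρ * ∫ η : USphere d, fderiv ℝ f (ρ • (η : Amb d)) η * polyFun P η ∂(surfaceMeasure d)) := by
  have hρ0 : 0 < ρ := ha.trans_lt hρ.1
  have hPc : Continuous fun η : USphere d => polyFun P (η : Amb d) :=
    (polyFun_contDiff P (n := 0)).continuous.comp continuous_subtype_val
  have hi : ∀ {u : USphere d → ℝ}, Continuous u → Integrable u (surfaceMeasure d) := fun hu =>
    hu.integrable_of_hasCompactSupport (HasCompactSupport.of_compactSpace _)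
  have h1 : Integrable (fun η : USphere d => f (ρ • (η : Amb d)) * polyFun P η)
      (surfaceMeasure d) :=
    hi ((hf.continuousOn.comp_continuous (by fun_prop) fun η => smul_mem_shell ha hρ η).mul hPc)
  have h2 : Integrable (fun η : USphere d => fderiv ℝ f (ρ • (η : Amb d)) η * polyFun P η)
      (surfaceMeasure d) := by
    refine hi (Continuous.mul ?_ hPc)
    refine Continuous.clm_apply ?_ continuous_subtype_val
    exact (hf.continuousOn_fderiv_of_isOpen isOpen_shell (by norm_num)).comp_continuous
      (by fun_prop) fun η => smul_mem_shell ha hρ η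
  have h3 := integral_sub (h1.const_mul (l : ℝ)) (h2.const_mul ρ)
  simp only [integral_const_mul] at h3
  rw [← h3, greenFlux, ← integral_const_mul, ← integral_const_mul, ← integral_const_mul]
  refine integral_congr_ae (Eventually.of_forall fun η => ?_)
  have hE := fderiv_polyFun_self hP (ρ • (η : Amb d))
  rw [map_smul, smul_eq_mul, polyFun_smul hP] at hE
  simp only [polyFun_smul hP]
  rw [pow_add]
  linear_combination ρ ^ d * f (ρ • (η : Amb d)) * hE

end

theorem hasDerivAt_pow_div {x : ℝ} (hx : x ≠ 0) (n : ℕ) :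
    HasDerivAt (fun t : ℝ => t ^ n) (n * x ^ n / x) x := by
  refine (hasDerivAt_pow n x).congr_deriv ?_
  rcases n with _ | n
  · simp
  · field_simp; simp; ring

/-- Solutions on `(r, ∞)` of the radial equation that vanish at infinity. -/
theorem radial_exterior {l m : ℕ} {r K : ℝ} (hr : 0 ≤ r) {u u' : ℝ → ℝ}
    (hu : ∀ ρ > r, HasDerivAt u (u' ρ) ρ)
    (hK : ∀ ρ > r, ρ ^ (m + 1 + 1 + l) * (l * u ρ - ρ * u' ρ) = ρ * K)
    (h0 : Tendsto u atTop (𝓝 0)) :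
    ∃ c, ∀ ρ > r, ρ ^ (l + m + 1) * u ρ = c := by
  -- Here `d = m + 2`, so `e = 2l + d - 1` is the gap between the exponents `l` and `-(l+d-1)` of
  -- the two solutions. The function `q` is the coefficient of `ρ^l` in `u`: it is constant, and
  -- decay forces it to vanish.
  set e : ℕ := 2 * l + m + 1 with he
  have he0 : (e : ℝ) ≠ 0 := by positivity
  set q : ℝ → ℝ := fun ρ => u ρ / ρ ^ l - K / e / ρ ^ e with hq
  have hqd : ∀ ρ ∈ Set.Ioi r, HasDerivAt q 0 ρ := by
    intro ρ hρ
    have hρ0 : 0 < ρ := hr.trans_lt hρ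
    have h1 := ((hu ρ hρ).div (hasDerivAt_pow_div hρ0.ne' l) (by positivity)).sub
      ((hasDerivAt_const ρ (K / e)).div (hasDerivAt_pow_div hρ0.ne' e) (by positivity))
    refine h1.congr_deriv ?_
    have h3 : ρ * (ρ ^ (m + 1 + l) * (l * u ρ - ρ * u' ρ)) = ρ * K := by rw [← hK ρ hρ]; ring
    rw [← mul_left_cancel₀ hρ0.ne' h3]
    field_simp
    rw [he]
    ring
  have hconst : ∀ x ∈ Set.Ioi r, ∀ y ∈ Set.Ioi r, q x = q y := fun x hx y hy =>
    isOpen_Ioi.is_const_of_deriv_eq_zero isPreconnected_Ioi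
      (fun z hz => (hqd z hz).differentiableAt.differentiableWithinAt)
      (fun z hz => (hqd z hz).deriv) hx hy
  have hlim : Tendsto q atTop (𝓝 0) := by
    have h1 : Tendsto (fun ρ : ℝ => u ρ / ρ ^ l) atTop (𝓝 0) := by
      rw [tendsto_zero_iff_norm_tendsto_zero] at h0 ⊢
      refine squeeze_zero' (Eventually.of_forall fun _ => norm_nonneg _) ?_ h0
      filter_upwards [eventually_ge_atTop (1 : ℝ)] with ρ hρ
      rw [norm_div, norm_pow, Real.norm_of_nonneg (zero_le_one.trans hρ)]
      exact div_le_self (norm_nonneg _) (one_le_pow₀ hρ)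
    have h2 : Tendsto (fun ρ : ℝ => K / e / ρ ^ e) atTop (𝓝 0) :=
      tendsto_const_nhds.div_atTop (tendsto_pow_atTop (by omega))
    simpa using h1.sub h2
  have hq0 : ∀ ρ > r, q ρ = 0 := by
    intro ρ hρ
    refine tendsto_nhds_unique (tendsto_const_nhds.congr' ?_) hlim
    filter_upwards [eventually_gt_atTop r] with t ht using hconst ρ hρ t ht
  refine ⟨K / e, fun ρ hρ => ?_⟩
  have hρ0 : 0 < ρ := hr.trans_lt hρ
  have h1 : u ρ / ρ ^ l = K / e / ρ ^ e := sub_eq_zero.1 (hq0 ρ hρ)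
  have h2 : ρ ^ e = ρ ^ (l + m + 1) * ρ ^ l := by rw [← pow_add]; congr 1; omega
  rw [h2] at h1
  field_simp at h1 ⊢
  linear_combination h1

/-- Solutions on `(0, b)` of the radial equation without flux. -/
theorem radial_interior {l n : ℕ} {b : ℝ} {u u' : ℝ → ℝ}
    (hu : ∀ ρ ∈ Set.Ioo 0 b, HasDerivAt u (u' ρ) ρ)
    (hK : ∀ ρ ∈ Set.Ioo 0 b, ρ ^ n * (l * u ρ - ρ * u' ρ) = 0) :
    ∃ c, ∀ ρ ∈ Set.Ioo 0 b, u ρ = c * ρ ^ l := by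
  by_cases hb : 0 < b
  swap
  · exact ⟨0, fun ρ hρ => absurd (hρ.1.trans hρ.2) hb⟩
  set q : ℝ → ℝ := fun ρ => u ρ / ρ ^ l with hq
  have hqd : ∀ ρ ∈ Set.Ioo 0 b, HasDerivAt q 0 ρ := by
    intro ρ hρ
    have hρ0 : 0 < ρ := hρ.1
    refine ((hu ρ hρ).div (hasDerivAt_pow_div hρ0.ne' l) (by positivity)).congr_deriv ?_
    have := (mul_eq_zero.1 (hK ρ hρ)).resolve_left (by positivity)
    field_simp
    linear_combination -this
  have hm : b / 2 ∈ Set.Ioo 0 b := ⟨by linarith, by linarith⟩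
  refine ⟨q (b / 2), fun ρ hρ => ?_⟩
  have : q ρ = q (b / 2) :=
    isOpen_Ioo.is_const_of_deriv_eq_zero isPreconnected_Ioo
      (fun z hz => (hqd z hz).differentiableAt.differentiableWithinAt)
      (fun z hz => (hqd z hz).deriv) hρ hm
  have hρ0 : 0 < ρ := hρ.1
  rw [← this, hq]
  field_simp

/-- By `radial_exterior`, `ρ^(l+d-1)` times the moment is constant for `ρ > r`; the constant is read
at `ρ = 1` and, by continuity, at `ρ = r`. -/
theorem integral_sphere_exterior {d l : ℕ} (hd : 2 ≤ d) {f : Amb d → ℝ} {r : ℝ} (hr : 0 < r)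
    (hr1 : r < 1)
    (hf : InnerProductSpace.HarmonicOnNhd f {x | r < ‖x‖})
    (hfc : ContinuousOn f {x | r ≤ ‖x‖}) (hf0 : Tendsto f (cocompact (Amb d)) (𝓝 0))
    {P : MvPolynomial (Fin (d + 1)) ℝ} (hP : P.IsHomogeneous l) (hΔ : polyLaplacian d P = 0) :
    ∫ η : USphere d, f η * polyFun P η ∂(surfaceMeasure d) =
      r ^ (l + d - 1) * ∫ η : USphere d, f (r • (η : Amb d)) * polyFun P η ∂(surfaceMeasure d) := by
  obtain ⟨m, rfl⟩ : ∃ m, d = m + 1 + 1 := ⟨d - 2, by omega⟩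
  have hPc : Continuous fun η : USphere (m + 1 + 1) => polyFun P (η : Amb (m + 1 + 1)) :=
    (polyFun_contDiff P (n := 0)).continuous.comp continuous_subtype_val
  set u : ℝ → ℝ := fun ρ => ∫ η : USphere (m + 1 + 1), f (ρ • (η : Amb (m + 1 + 1))) *
    polyFun P η ∂(surfaceMeasure (m + 1 + 1)) with hu
  have hn : ∀ (ρ : ℝ), 0 ≤ ρ → ∀ η : USphere (m + 1 + 1), ‖ρ • (η : Amb (m + 1 + 1))‖ = ρ :=
    fun ρ hρ η => by rw [norm_smul, norm_eq_of_mem_sphere, mul_one, Real.norm_of_nonneg hρ]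
  have hsh : ∀ b, InnerProductSpace.HarmonicOnNhd f (shell (m + 1 + 1) r b) := fun b x hx =>
    hf x hx.1
  have hsh1 : ∀ b, ContDiffOn ℝ 1 f (shell (m + 1 + 1) r b) := fun b =>
    (hsh b).contDiffOn.of_le (by norm_num)
  have hmem : ∀ ρ, r < ρ → ρ ∈ Set.Ioo r (ρ + 1) := fun ρ hρ => ⟨hρ, by linarith⟩
  have hflux : ∀ s t, r < s → r < t → greenFlux (m + 1 + 1) f (polyFun P) s =
      greenFlux (m + 1 + 1) f (polyFun P) t := fun s t hs ht =>
    greenFlux_const (b := max s t + 1) hr.le (hsh _) (harmonic_polyFun hΔ _)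
      ⟨hs, by linarith [le_max_left s t]⟩ ⟨ht, by linarith [le_max_right s t]⟩
  obtain ⟨C, hC⟩ := (isCompact_univ (X := USphere (m + 1 + 1))).exists_bound_of_continuousOn
    hPc.continuousOn
  have hu0 : Tendsto u atTop (𝓝 0) := by
    have hz : (0 : ℝ) = ∫ _ : USphere (m + 1 + 1), (0 : ℝ) ∂(surfaceMeasure (m + 1 + 1)) := by simp
    rw [hz]
    refine tendsto_integral_filter_of_dominated_convergence (fun _ => C) ?_ ?_
      (integrable_const _) ?_
    · filter_upwards [eventually_gt_atTop r] with ρ hρ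
      refine (Continuous.mul ?_ hPc).aestronglyMeasurable
      exact hfc.comp_continuous (by fun_prop) fun η => by
        rw [Set.mem_ofPred_eq, hn ρ (hr.le.trans hρ.le)]; exact hρ.le
    · have h1 : ∀ᶠ x in cocompact (Amb (m + 1 + 1)), ‖f x‖ ≤ 1 := by
        have := hf0.norm
        rw [norm_zero] at this
        exact this.eventually (eventually_le_nhds one_pos)
      rw [← Metric.cobounded_eq_cocompact, ← comap_norm_atTop, eventually_comap] at h1
      filter_upwards [h1, eventually_ge_atTop (0 : ℝ)] with ρ h hρ
      refine Eventually.of_forall fun η => ?_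
      rw [norm_mul]
      have := h _ (hn ρ hρ η)
      exact (mul_le_of_le_one_left (norm_nonneg _) this).trans (hC η trivial)
    · refine Eventually.of_forall fun η => ?_
      have : Tendsto (fun ρ : ℝ => ρ • (η : Amb (m + 1 + 1))) atTop (cocompact _) := by
        rw [← Metric.cobounded_eq_cocompact, ← comap_norm_atTop, tendsto_comap_iff]
        refine tendsto_id.congr' ?_
        filter_upwards [eventually_ge_atTop (0 : ℝ)] with ρ hρ using (hn ρ hρ η).symm
      simpa using (hf0.comp this).mul_const (polyFun P (η : Amb (m + 1 + 1)))
  obtain ⟨c, hc⟩ := radial_exterior (l := l) (m := m) (r := r)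
    (K := greenFlux (m + 1 + 1) f (polyFun P) 1) hr.le
    (fun ρ hρ => hasDerivAt_integral_mul_polyFun (P := P) hr.le (hsh1 (ρ + 1)) (hmem ρ hρ))
    (fun ρ hρ => by
      rw [hflux 1 ρ hr1 hρ, greenFlux_polyFun hr.le (hsh1 (ρ + 1)) hP (hmem ρ hρ)]) hu0
  -- The radial equation holds only for `ρ > r`; continuity of `f` up to `rS^d` carries the result
  -- to the endpoint.
  have hcont : ContinuousOn u (Set.Ici r) := by
    refine continuousOn_integral_sphere (F := fun ρ (η : USphere (m + 1 + 1)) =>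
      f (ρ • (η : Amb (m + 1 + 1))) * polyFun P η) ?_
    refine ContinuousOn.mul ?_ (hPc.comp continuous_snd).continuousOn
    refine hfc.comp (by fun_prop) fun p hp => ?_
    rw [Set.mem_ofPred_eq, hn p.1 (hr.le.trans hp.1)]
    exact hp.1
  have hlim : Tendsto (fun ρ => ρ ^ (l + m + 1) * u ρ) (𝓝[>] r) (𝓝 (r ^ (l + m + 1) * u r)) := by
    refine Tendsto.mul ?_ ((hcont r Set.self_mem_Ici).mono_left (nhdsWithin_mono _ Set.Ioi_subset_Ici_self))
    exact ((continuous_pow _).tendsto r).mono_left nhdsWithin_le_nhds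
  have hr' : r ^ (l + m + 1) * u r = c := by
    refine tendsto_nhds_unique hlim (tendsto_const_nhds.congr' ?_)
    filter_upwards [self_mem_nhdsWithin] with ρ hρ using (hc ρ hρ).symm
  have h1 := hc 1 hr1
  rw [one_pow, one_mul] at h1
  have : l + (m + 1 + 1) - 1 = l + m + 1 := by omega
  rw [this, hr', ← h1]
  simp

/-- For a function harmonic in the whole ball, the constant flux is its limit at radius `0`, which
the factor `ρ^d` makes zero. Only the solution `ρ^l` survives. -/
theorem integral_sphere_interior {d l : ℕ} (hd : 1 ≤ d) {f : Amb d → ℝ} {b : ℝ}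
    (hf : InnerProductSpace.HarmonicOnNhd f (Metric.ball 0 b))
    {P : MvPolynomial (Fin (d + 1)) ℝ} (hP : P.IsHomogeneous l) (hΔ : polyLaplacian d P = 0) :
    ∃ c, ∀ ρ ∈ Set.Ioo 0 b,
      ∫ η : USphere d, f (ρ • (η : Amb d)) * polyFun P η ∂(surfaceMeasure d) = c * ρ ^ l := by
  have hn : ∀ (ρ : ℝ), 0 ≤ ρ → ∀ η : USphere d, ‖ρ • (η : Amb d)‖ = ρ :=
    fun ρ hρ η => by rw [norm_smul, norm_eq_of_mem_sphere, mul_one, Real.norm_of_nonneg hρ]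
  have hsh : InnerProductSpace.HarmonicOnNhd f (shell d 0 b) := fun x hx =>
    hf x (by simpa using hx.2)
  have hsh1 : ContDiffOn ℝ 1 f (shell d 0 b) := hsh.contDiffOn.of_le (by norm_num)
  have hball : Set.MapsTo (fun p : ℝ × USphere d => p.1 • (p.2 : Amb d))
      (Set.Ico 0 b ×ˢ Set.univ) (Metric.ball 0 b) := fun p hp => by
    simpa [hn p.1 hp.1.1] using hp.1.2
  have hcf : ∀ {f : Amb d → ℝ}, InnerProductSpace.HarmonicOnNhd f (Metric.ball 0 b) →
      ContinuousOn (fun p : ℝ × USphere d => f (p.1 • (p.2 : Amb d)))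
        (Set.Ico 0 b ×ˢ Set.univ) := fun hf =>
    hf.contDiffOn.continuousOn.comp (by fun_prop) hball
  have hcd : ∀ {f : Amb d → ℝ}, InnerProductSpace.HarmonicOnNhd f (Metric.ball 0 b) →
      ContinuousOn (fun p : ℝ × USphere d => fderiv ℝ f (p.1 • (p.2 : Amb d)) p.2)
        (Set.Ico 0 b ×ˢ Set.univ) := fun {f} hf => by
    refine ContinuousOn.clm_apply (f := fun p : ℝ × USphere d => fderiv ℝ f (p.1 • (p.2 : Amb d)))
      (g := fun p : ℝ × USphere d => (p.2 : Amb d)) ?_ (by fun_prop)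
    exact (hf.contDiffOn.continuousOn_fderiv_of_isOpen Metric.isOpen_ball (by norm_num)).comp
      (by fun_prop) hball
  have hg := harmonic_polyFun hΔ (Metric.ball (0 : Amb d) b)
  have hcont : ContinuousOn (greenFlux d f (polyFun P)) (Set.Ico 0 b) :=
    (continuousOn_id.pow d).mul (continuousOn_integral_sphere
      (((hcf hf).mul (hcd hg)).sub ((hcf hg).mul (hcd hf))))
  have hflux : ∀ ρ ∈ Set.Ioo 0 b, greenFlux d f (polyFun P) ρ = 0 := by
    intro ρ hρ
    have h0 : greenFlux d f (polyFun P) 0 = 0 := by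
      rw [greenFlux, zero_pow (by omega), zero_mul]
    have h1 : Tendsto (greenFlux d f (polyFun P)) (𝓝[Set.Ioo 0 b] 0) (𝓝 0) := by
      have := (hcont 0 ⟨le_rfl, hρ.1.trans hρ.2⟩).mono_left
        (nhdsWithin_mono (0 : ℝ) Set.Ioo_subset_Ico_self)
      rwa [h0] at this
    have : (𝓝[Set.Ioo 0 b] (0 : ℝ)).NeBot := left_nhdsWithin_Ioo_neBot (hρ.1.trans hρ.2)
    refine tendsto_nhds_unique (tendsto_const_nhds.congr' ?_) h1
    filter_upwards [self_mem_nhdsWithin] with t ht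
      using greenFlux_const le_rfl hsh (harmonic_polyFun hΔ _) hρ ht
  refine radial_interior (n := d + l)
    (fun ρ hρ => hasDerivAt_integral_mul_polyFun (P := P) le_rfl hsh1 hρ) fun ρ hρ => ?_
  rw [← greenFlux_polyFun le_rfl hsh1 hP hρ, hflux ρ hρ, mul_zero]

/-! ### Harmonicity of the Newtonian kernel. -/

/-- The Newtonian kernel `‖x - y‖^(1-d)`. -/
noncomputable def newtonKernel (d : ℕ) (x y : Amb d) : ℝ := (‖x - y‖ ^ (d - 1))⁻¹

theorem hasFDerivAt_inv_norm_pow {d n : ℕ} {z : Amb d} (hz : z ≠ 0) :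
    HasFDerivAt (fun y : Amb d => (‖y‖ ^ n)⁻¹)
      ((-(n : ℝ) * (‖z‖ ^ (n + 2))⁻¹) • innerSL ℝ z) z := by
  have hz' : ‖z‖ ≠ 0 := norm_ne_zero_iff.2 hz
  have h1 : HasDerivAt (fun t : ℝ => (t ^ n)⁻¹) (-(n * ‖z‖ ^ n / ‖z‖) / (‖z‖ ^ n) ^ 2) ‖z‖ :=
    (hasDerivAt_pow_div hz' n).fun_inv (by positivity)
  have h2 := h1.comp_hasFDerivAt z (hasFDerivAt_norm_of_ne_zero hz)
  refine h2.congr_fderiv ?_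
  rw [smul_smul]
  congr 1
  field_simp
  ring

theorem hasFDerivAt_newtonKernel {d : ℕ} {x y : Amb d} (hxy : x ≠ y) :
    HasFDerivAt (newtonKernel d x)
      ((((d - 1 : ℕ) : ℝ) * (‖x - y‖ ^ (d - 1 + 2))⁻¹) • innerSL ℝ (x - y)) y := by
  have h1 := hasFDerivAt_inv_norm_pow (n := d - 1) (sub_ne_zero.2 hxy)
  have h2 : HasFDerivAt (fun y : Amb d => x - y) (-(ContinuousLinearMap.id ℝ (Amb d))) y := by
    simpa using (hasFDerivAt_id y).const_sub x
  refine (h1.comp y h2).congr_fderiv ?_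
  ext v
  simp

theorem harmonic_newtonKernel {d : ℕ} (hd : 1 ≤ d) (x : Amb d) :
    InnerProductSpace.HarmonicOnNhd (newtonKernel d x) {x}ᶜ := by
  have hsm : ∀ y ∈ ({x}ᶜ : Set (Amb d)), ContDiffAt ℝ 2 (newtonKernel d x) y := by
    intro y hy
    have hxy : x - y ≠ 0 := sub_ne_zero.2 fun h => hy h.symm
    have h1 : ContDiffAt ℝ 2 (fun y => ‖x - y‖) y :=
      (contDiffAt_norm ℝ hxy).comp y (contDiffAt_const.sub contDiffAt_id)
    exact (h1.pow _).inv (pow_ne_zero _ (norm_ne_zero_iff.2 hxy))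
  refine fun y hy => ⟨hsm y hy, ?_⟩
  filter_upwards [isOpen_compl_singleton.mem_nhds hy] with y hy
  rw [laplacian_eq_sum_fderiv (hsm y hy)]
  have hxy : x - y ≠ 0 := sub_ne_zero.2 fun h => hy h.symm
  have hnz : ‖x - y‖ ≠ 0 := norm_ne_zero_iff.2 hxy
  set n := d - 1 with hn
  have hterm : ∀ i, fderiv ℝ (fun z => fderiv ℝ (newtonKernel d x) z (stdVec i)) y (stdVec i) =
      n * ((n + 2) * (‖x - y‖ ^ (n + 4))⁻¹ * (x i - y i) ^ 2 - (‖x - y‖ ^ (n + 2))⁻¹) := by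
    intro i
    have h1 : (fun z => fderiv ℝ (newtonKernel d x) z (stdVec i)) =ᶠ[𝓝 y]
        fun z => (n : ℝ) * ((‖x - z‖ ^ (n + 2))⁻¹ * (x i - z i)) := by
      filter_upwards [isOpen_compl_singleton.mem_nhds hy] with z hz
      rw [(hasFDerivAt_newtonKernel (fun h => hz h.symm)).fderiv]
      simp [EuclideanSpace.inner_single_right, mul_assoc, hn]
    rw [h1.fderiv_eq]
    have h2 : HasFDerivAt (fun z : Amb d => x - z) (-(ContinuousLinearMap.id ℝ (Amb d))) y := by
      simpa using (hasFDerivAt_id y).const_sub x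
    have h3 : HasFDerivAt (fun z : Amb d => (‖x - z‖ ^ (n + 2))⁻¹) _ y :=
      (hasFDerivAt_inv_norm_pow (n := n + 2) hxy).comp y h2
    have h4 : HasFDerivAt (fun z : Amb d => x i - z i)
        (-(EuclideanSpace.proj i : Amb d →L[ℝ] ℝ)) y :=
      ((EuclideanSpace.proj i : Amb d →L[ℝ] ℝ).hasFDerivAt).const_sub (x i)
    have h5 : HasFDerivAt (fun z => (n : ℝ) * ((‖x - z‖ ^ (n + 2))⁻¹ * (x i - z i))) _ y :=
      (h3.mul h4).const_mul (n : ℝ)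
    rw [h5.fderiv]
    simp [EuclideanSpace.inner_single_right]
    ring
  have hsq : ∑ i, (x i - y i) ^ 2 = ‖x - y‖ ^ 2 := by
    rw [EuclideanSpace.norm_sq_eq]
    simp
  simp only [hterm, ← Finset.mul_sum, Finset.sum_sub_distrib, hsq, Pi.zero_apply]
  simp only [Finset.sum_const, Finset.card_univ, Fintype.card_fin, nsmul_eq_mul]
  -- The number of coordinates is exactly what makes the two parts of the Laplacian cancel.
  have hdn : ((d + 1 : ℕ) : ℝ) = n + 2 := by
    have : d + 1 = n + 2 := by omega
    rw [this]; push_cast; ring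
  rw [hdn]
  rw [pow_add _ n 4, pow_add _ n 2]
  field_simp
  ring

/-! ### The Poisson kernel and the eigenvalues of the single layer operator. -/

theorem sphereArea_eq (d : ℕ) : sphereArea d = (surfaceMeasure d).real Set.univ := by
  rw [surfaceMeasure, Measure.toSphere_real_apply_univ, sphereArea, measureReal_def,
    EuclideanSpace.volume_ball]
  have h0 : (0 : ℝ) < ((d : ℝ) + 1) / 2 := by positivity
  have hG : 0 < Real.Gamma (((d : ℝ) + 1) / 2) := Real.Gamma_pos_of_pos h0
  have h1 : Real.Gamma (((d : ℝ) + 1) / 2 + 1) =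
      ((d : ℝ) + 1) / 2 * Real.Gamma (((d : ℝ) + 1) / 2) := Real.Gamma_add_one h0.ne'
  have h2 : √Real.pi ^ (d + 1) = Real.pi ^ (((d : ℝ) + 1) / 2) := by
    rw [Real.sqrt_eq_rpow, ← Real.rpow_natCast, ← Real.rpow_mul Real.pi_pos.le]
    congr 1
    push_cast
    ring
  have h3 : 0 ≤ Real.pi ^ (((d : ℝ) + 1) / 2) / (((d : ℝ) + 1) / 2 * Real.Gamma (((d : ℝ) + 1) / 2)) := by
    positivity
  simp only [Fintype.card_fin, finrank_euclideanSpace, Nat.cast_add, Nat.cast_one, h1, h2,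
    ENNReal.ofReal_one, one_pow, one_mul]
  rw [ENNReal.toReal_ofReal h3]
  field_simp

theorem surfaceMeasure_real_univ_pos (d : ℕ) : 0 < (surfaceMeasure d).real Set.univ := by
  rw [← sphereArea_eq, sphereArea]
  have : (0 : ℝ) < ((d : ℝ) + 1) / 2 := by positivity
  have := Real.Gamma_pos_of_pos this
  have := Real.pi_pos
  positivity

/-- The (unnormalized) Poisson kernel of the unit ball, evaluated at `s η`. -/
noncomputable def spherePoisson (d : ℕ) (x : Amb d) (s : ℝ) (η : USphere d) : ℝ :=
  (1 - s ^ 2) * (‖x - s • (η : Amb d)‖ ^ (d + 1))⁻¹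

section
variable {d l : ℕ} {x : Amb d}

theorem norm_smul_sphere {ρ : ℝ} (hρ : 0 ≤ ρ) (η : USphere d) : ‖ρ • (η : Amb d)‖ = ρ := by
  rw [norm_smul, norm_eq_of_mem_sphere, mul_one, Real.norm_of_nonneg hρ]

theorem sub_smul_sphere_ne_zero {ρ : ℝ} (hρ : 0 ≤ ρ) (hρx : ρ ≠ ‖x‖) (η : USphere d) :
    x - ρ • (η : Amb d) ≠ 0 := fun h => hρx <| by
  rw [sub_eq_zero.1 h, norm_smul_sphere hρ]

theorem continuous_newtonKernel_sphere {ρ : ℝ} (hρ : 0 ≤ ρ) (hρx : ρ ≠ ‖x‖) :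
    Continuous fun η : USphere d => newtonKernel d x (ρ • (η : Amb d)) := by
  unfold newtonKernel
  refine Continuous.inv₀ (by fun_prop) fun η => ?_
  exact pow_ne_zero _ (norm_ne_zero_iff.2 (sub_smul_sphere_ne_zero hρ hρx η))

theorem continuous_spherePoisson {ρ : ℝ} (hρ : 0 ≤ ρ) (hρx : ρ ≠ ‖x‖) :
    Continuous (spherePoisson d x ρ) := by
  unfold spherePoisson
  refine continuous_const.mul (Continuous.inv₀ (by fun_prop) fun η => ?_)
  exact pow_ne_zero _ (norm_ne_zero_iff.2 (sub_smul_sphere_ne_zero hρ hρx η))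

theorem Continuous.integrable_surfaceMeasure {u : USphere d → ℝ} (hu : Continuous u) :
    Integrable u (surfaceMeasure d) :=
  hu.integrable_of_hasCompactSupport (HasCompactSupport.of_compactSpace _)

theorem polyFun_continuous_sphere (P : MvPolynomial (Fin (d + 1)) ℝ) :
    Continuous fun η : USphere d => polyFun P (η : Amb d) :=
  (polyFun_contDiff P (n := 0)).continuous.comp continuous_subtype_val

/-- The operator `2s ∂_s + (d-1)` sends the Newtonian kernel to `d-1` times the Poisson kernel. On
`s^l` it acts as multiplication by `2l + d - 1`, the numerator of the symbol of `D`. -/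
theorem spherePoisson_eq (hd : 1 ≤ d) (hx : ‖x‖ = 1) {s : ℝ} (hs : s ∈ Set.Ioo 0 1)
    (η : USphere d) :
    (d - 1 : ℝ) * spherePoisson d x s η =
      2 * s * fderiv ℝ (newtonKernel d x) (s • (η : Amb d)) η +
        (d - 1) * newtonKernel d x (s • (η : Amb d)) := by
  have hne : x - s • (η : Amb d) ≠ 0 := sub_smul_sphere_ne_zero hs.1.le (by rw [hx]; exact hs.2.ne) η
  have hn0 : ‖x - s • (η : Amb d)‖ ≠ 0 := norm_ne_zero_iff.2 hne
  have h1 : s * inner ℝ (x - s • (η : Amb d)) η * 2 + ‖x - s • (η : Amb d)‖ ^ 2 = 1 - s ^ 2 := by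
    rw [norm_sub_sq_real, inner_sub_left, inner_smul_left, inner_smul_right, hx,
      norm_smul_sphere hs.1.le, real_inner_self_eq_norm_sq, norm_eq_of_mem_sphere]
    simp
    ring
  rw [(hasFDerivAt_newtonKernel (sub_ne_zero.1 hne)).fderiv, spherePoisson, newtonKernel, ← h1]
  obtain ⟨n, rfl⟩ : ∃ n, d = n + 1 := ⟨d - 1, by omega⟩
  simp only [Nat.add_sub_cancel, Nat.cast_add, Nat.cast_one, add_sub_cancel_right, smul_apply,
    innerSL_apply_apply, smul_eq_mul]
  field_simp
  ring

theorem exists_integral_newtonKernel (hd : 2 ≤ d) (hx : ‖x‖ = 1)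
    {P : MvPolynomial (Fin (d + 1)) ℝ} (hP : P.IsHomogeneous l) (hΔ : polyLaplacian d P = 0) :
    ∃ c, ∀ s ∈ Set.Ioo (0 : ℝ) 1,
      ∫ η : USphere d, newtonKernel d x (s • (η : Amb d)) * polyFun P η ∂(surfaceMeasure d) =
        c * s ^ l ∧
      (d - 1 : ℝ) * ∫ η : USphere d, spherePoisson d x s η * polyFun P η ∂(surfaceMeasure d) =
        (2 * l + d - 1) * (c * s ^ l) := by
  have hharm : InnerProductSpace.HarmonicOnNhd (newtonKernel d x) (Metric.ball 0 1) := fun y hy =>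
    harmonic_newtonKernel (by omega) x y fun h => by
      rw [Set.mem_singleton_iff.1 h, mem_ball_zero_iff, hx] at hy
      exact lt_irrefl _ hy
  have hC1 : ContDiffOn ℝ 1 (newtonKernel d x) (shell d 0 1) := fun y hy =>
    (hharm.contDiffOn.of_le (by norm_num) y (by simpa using hy.2)).mono fun z hz => by
      simpa using hz.2
  obtain ⟨c, hc⟩ := integral_sphere_interior (by omega) hharm hP hΔ
  refine ⟨c, fun s hs => ⟨hc s hs, ?_⟩⟩
  have hs0 : s ≠ 0 := hs.1.ne'
  have hsx : s ≠ ‖x‖ := by rw [hx]; exact hs.2.ne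
  have hD := hasDerivAt_integral_mul_polyFun (P := P) le_rfl hC1 hs
  have hD' : HasDerivAt (fun t : ℝ => c * t ^ l) (c * (l * s ^ l / s)) s :=
    (hasDerivAt_pow_div hs0 l).const_mul c
  -- The moment is differentiated both as `c s^l` and under the integral sign.
  have heq := (hD'.congr_of_eventuallyEq (by
    filter_upwards [isOpen_Ioo.mem_nhds hs] with t ht using hc t ht)).unique hD
  have hi1 : Integrable (fun η : USphere d => newtonKernel d x (s • (η : Amb d)) * polyFun P η)
      (surfaceMeasure d) :=
    ((continuous_newtonKernel_sphere hs.1.le hsx).mul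
      (polyFun_continuous_sphere P)).integrable_surfaceMeasure
  have hi2 : Integrable (fun η : USphere d =>
      fderiv ℝ (newtonKernel d x) (s • (η : Amb d)) η * polyFun P η) (surfaceMeasure d) := by
    refine (Continuous.mul ?_ (polyFun_continuous_sphere P)).integrable_surfaceMeasure
    refine Continuous.clm_apply ?_ continuous_subtype_val
    exact (hC1.continuousOn_fderiv_of_isOpen isOpen_shell (by norm_num)).comp_continuous
      (by fun_prop) fun η => smul_mem_shell le_rfl hs η
  have hsplit := integral_add (hi2.const_mul (2 * s)) (hi1.const_mul ((d : ℝ) - 1))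
  rw [integral_const_mul, integral_const_mul, ← heq, hc s hs] at hsplit
  rw [← integral_const_mul]
  calc _ = 2 * s * (c * (l * s ^ l / s)) + (d - 1) * (c * s ^ l) := by
        rw [← hsplit]
        refine integral_congr_ae (Eventually.of_forall fun η => ?_)
        simp only
        rw [← mul_assoc, spherePoisson_eq (by omega) hx hs]
        ring
    _ = _ := by field_simp; ring

/-- This is the case `l = 0`, with the constant found as `s → 0`, where the Newtonian kernel becomes
`1` because `‖x‖ = 1`. -/
theorem integral_spherePoisson (hd : 2 ≤ d) (hx : ‖x‖ = 1) {s : ℝ} (hs : s ∈ Set.Ioo (0 : ℝ) 1) :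
    ∫ η, spherePoisson d x s η ∂(surfaceMeasure d) = (surfaceMeasure d).real Set.univ := by
  have hone : ∀ y : Amb d, polyFun (1 : MvPolynomial (Fin (d + 1)) ℝ) y = 1 := fun y => by
    simp [polyFun]
  have hΔ : polyLaplacian d 1 = 0 := by simp [polyLaplacian]
  obtain ⟨c, hc⟩ := exists_integral_newtonKernel (l := 0) hd hx
    (MvPolynomial.isHomogeneous_one (Fin (d + 1)) ℝ) hΔ
  simp only [hone, mul_one, pow_zero, Nat.cast_zero, mul_zero, zero_add] at hc
  have hcont : ContinuousOn (fun t : ℝ => ∫ η : USphere d, newtonKernel d x (t • (η : Amb d))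
      ∂(surfaceMeasure d)) (Set.Ico 0 1) := by
    refine continuousOn_integral_sphere
      (F := fun t (η : USphere d) => newtonKernel d x (t • (η : Amb d))) ?_
    simp only [Function.uncurry_def, newtonKernel]
    refine ContinuousOn.inv₀ (by fun_prop) fun p hp => ?_
    exact pow_ne_zero _ (norm_ne_zero_iff.2
      (sub_smul_sphere_ne_zero hp.1.1 (by rw [hx]; exact hp.1.2.ne) p.2))
  have h0 : Tendsto (fun t : ℝ => ∫ η : USphere d, newtonKernel d x (t • (η : Amb d))
      ∂(surfaceMeasure d)) (𝓝[Set.Ioo 0 1] 0) (𝓝 ((surfaceMeasure d).real Set.univ)) := by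
    have := (hcont 0 ⟨le_rfl, one_pos⟩).mono_left (nhdsWithin_mono (0 : ℝ) Set.Ioo_subset_Ico_self)
    simpa [newtonKernel, hx] using this
  have : (𝓝[Set.Ioo 0 1] (0 : ℝ)).NeBot := left_nhdsWithin_Ioo_neBot one_pos
  have hcω : c = (surfaceMeasure d).real Set.univ := by
    refine tendsto_nhds_unique (tendsto_const_nhds.congr' ?_) h0
    filter_upwards [self_mem_nhdsWithin] with t ht using (hc t ht).1.symm
  have hd1 : (d : ℝ) - 1 ≠ 0 := by
    have : (2 : ℝ) ≤ d := by exact_mod_cast hd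
    linarith
  rw [← hcω]
  exact mul_left_cancel₀ hd1 (hc s hs).2

/-- The Poisson kernel is an approximate identity at the boundary. -/
theorem tendsto_integral_spherePoisson (hd : 2 ≤ d) (x : USphere d) {g : USphere d → ℝ}
    (hg : Continuous g) :
    Tendsto (fun s => ∫ η, spherePoisson d x s η * g η ∂(surfaceMeasure d)) (𝓝[Set.Ioo 0 1] 1)
      (𝓝 ((surfaceMeasure d).real Set.univ * g x)) := by
  have hx : ‖(x : Amb d)‖ = 1 := norm_eq_of_mem_sphere x
  set ω := (surfaceMeasure d).real Set.univ with hω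
  have hω0 : 0 < ω := surfaceMeasure_real_univ_pos d
  have hpos : ∀ s ∈ Set.Ioo (0 : ℝ) 1, ∀ η, 0 ≤ spherePoisson d x s η := fun s hs η => by
    have : 0 ≤ 1 - s ^ 2 := by nlinarith [hs.1, hs.2]
    unfold spherePoisson
    positivity
  have key := tendsto_integral_peak_smul_of_integrable_of_tendsto (μ := surfaceMeasure d)
    (l := 𝓝[Set.Ioo 0 1] (1 : ℝ)) (φ := fun s η => ω⁻¹ * spherePoisson d x s η) (g := g)
    (x₀ := x) (a := g x) (t := Set.univ) MeasurableSet.univ univ_mem (measure_ne_top _ _)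
    (by filter_upwards [self_mem_nhdsWithin] with s hs η
        exact mul_nonneg (inv_nonneg.2 hω0.le) (hpos s hs η))
    ?_ ?_ ?_ hg.integrable_surfaceMeasure (hg.tendsto x)
  · have := key.const_mul ω
    refine this.congr fun s => ?_
    rw [← integral_const_mul]
    refine integral_congr_ae (Eventually.of_forall fun η => ?_)
    simp only [smul_eq_mul]
    field_simp
  · intro u hu hxu
    obtain ⟨δ, hδ, hball⟩ := Metric.isOpen_iff.1 hu x hxu
    rw [Metric.tendstoUniformlyOn_iff]
    intro ε hε
    have hlim : Tendsto (fun s : ℝ => ω⁻¹ * ((1 - s ^ 2) * ((δ / 2) ^ (d + 1))⁻¹))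
        (𝓝[Set.Ioo 0 1] 1) (𝓝 0) := by
      have : Continuous fun s : ℝ => ω⁻¹ * ((1 - s ^ 2) * ((δ / 2) ^ (d + 1))⁻¹) := by fun_prop
      simpa using (this.tendsto 1).mono_left nhdsWithin_le_nhds
    have hnear : ∀ᶠ s in 𝓝[Set.Ioo 0 1] (1 : ℝ), 1 - δ / 2 < s :=
      mem_nhdsWithin_of_mem_nhds (lt_mem_nhds (by linarith))
    filter_upwards [self_mem_nhdsWithin, hnear, hlim.eventually (gt_mem_nhds hε)]
      with s hs hsδ hsε η hη
    have hdist : δ ≤ ‖(x : Amb d) - η‖ := by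
      by_contra hlt
      push Not at hlt
      refine hη (hball ?_)
      rw [Metric.mem_ball, Subtype.dist_eq, dist_comm, dist_eq_norm]
      exact hlt
    have h1 : ‖(η : Amb d) - s • (η : Amb d)‖ = 1 - s := by
      have : (η : Amb d) - s • (η : Amb d) = (1 - s) • (η : Amb d) := by rw [sub_smul, one_smul]
      rw [this, norm_smul_sphere (by linarith [hs.2])]
    -- Moving from `η` to `sη` costs `1 - s < δ/2` of the distance `δ`.
    have hlow : δ / 2 ≤ ‖(x : Amb d) - s • (η : Amb d)‖ := by
      have h2 : ‖(x : Amb d) - η‖ ≤ ‖(x : Amb d) - s • (η : Amb d)‖ +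
          ‖(η : Amb d) - s • (η : Amb d)‖ := by
        have := norm_sub_le ((x : Amb d) - s • (η : Amb d)) ((η : Amb d) - s • (η : Amb d))
        simpa using this
      rw [h1] at h2
      linarith
    have h3 : 0 ≤ 1 - s ^ 2 := by nlinarith [hs.1, hs.2]
    rw [Pi.zero_apply, dist_comm, Real.dist_0_eq_abs, abs_of_nonneg
      (mul_nonneg (inv_nonneg.2 hω0.le) (hpos s hs η))]
    refine lt_of_le_of_lt ?_ hsε
    unfold spherePoisson
    gcongr
  · refine tendsto_const_nhds.congr' ?_
    filter_upwards [self_mem_nhdsWithin] with s hs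
    rw [setIntegral_univ, integral_const_mul, integral_spherePoisson hd hx hs,
      inv_mul_cancel₀ hω0.ne']
  · filter_upwards [self_mem_nhdsWithin] with s hs
    exact (continuous_const.mul (continuous_spherePoisson hs.1.le
      (by rw [hx]; exact hs.2.ne))).aestronglyMeasurable

/-- The single layer potential of a spherical harmonic. -/
theorem integral_newtonKernel_mul_polyFun (hd : 2 ≤ d) (x : USphere d)
    {P : MvPolynomial (Fin (d + 1)) ℝ} (hP : P.IsHomogeneous l) (hΔ : polyLaplacian d P = 0)
    {s : ℝ} (hs : s ∈ Set.Ioo (0 : ℝ) 1) :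
    symbolD d l * ∫ η : USphere d, newtonKernel d x (s • (η : Amb d)) * polyFun P η
      ∂(surfaceMeasure d) = s ^ l * polyFun P x := by
  have hx : ‖(x : Amb d)‖ = 1 := norm_eq_of_mem_sphere x
  obtain ⟨c, hc⟩ := exists_integral_newtonKernel hd hx hP hΔ
  have h1 := (tendsto_integral_spherePoisson hd x (polyFun_continuous_sphere P)).const_mul
    ((d : ℝ) - 1)
  have h2 : Tendsto (fun s : ℝ => (2 * (l : ℝ) + d - 1) * (c * s ^ l)) (𝓝[Set.Ioo 0 1] 1)
      (𝓝 ((2 * (l : ℝ) + d - 1) * c)) := by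
    have : Continuous fun s : ℝ => (2 * (l : ℝ) + d - 1) * (c * s ^ l) := by fun_prop
    simpa using (this.tendsto 1).mono_left nhdsWithin_le_nhds
  have : (𝓝[Set.Ioo 0 1] (1 : ℝ)).NeBot := right_nhdsWithin_Ioo_neBot one_pos
  -- Two limits of the Poisson integral as `s → 1` determine `c`: the approximate identity, and the
  -- formula in `s^l`.
  have h3 : (2 * (l : ℝ) + d - 1) * c =
      ((d : ℝ) - 1) * ((surfaceMeasure d).real Set.univ * polyFun P x) := by
    refine tendsto_nhds_unique (h2.congr' ?_) h1
    filter_upwards [self_mem_nhdsWithin] with t ht using (hc t ht).2.symm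
  have hd1 : (d : ℝ) - 1 ≠ 0 := by
    have : (2 : ℝ) ≤ d := by exact_mod_cast hd
    linarith
  have hω := (surfaceMeasure_real_univ_pos d).ne'
  rw [(hc s hs).1, symbolD, sphereArea_eq]
  field_simp
  linear_combination h3 * s ^ l

end

/-! ### Hölder's inequality and coefficients in the harmonic basis. -/

theorem abs_integral_mul_le_eLpNorm {α : Type*} [MeasurableSpace α] {μ : Measure α}
    {p q : ℝ≥0∞} [ENNReal.HolderTriple p q 1] {u v : α → ℝ} (hu : MemLp u p μ) (hv : MemLp v q μ) :
    |∫ x, u x * v x ∂μ| ≤ (eLpNorm u p μ).toReal * (eLpNorm v q μ).toReal := by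
  have h1 := eLpNorm_smul_le_mul_eLpNorm (p := p) (q := q) (r := 1) hv.1 hu.1
  rw [← Real.norm_eq_abs, ← ENNReal.toReal_mul]
  refine (norm_integral_le_integral_norm _).trans ?_
  rw [integral_norm_eq_lintegral_enorm (f := fun x => u x * v x) (hu.1.mul hv.1)]
  rw [eLpNorm_one_eq_lintegral_enorm] at h1
  exact ENNReal.toReal_mono (ENNReal.mul_ne_top hu.eLpNorm_ne_top hv.eLpNorm_ne_top) h1

theorem MeasureTheory.MemLp.integrable_fun_mul {α : Type*} [MeasurableSpace α] {μ : Measure α}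
    {p q : ℝ≥0∞} [ENNReal.HolderTriple p q 1] {u v : α → ℝ} (hu : MemLp u p μ) (hv : MemLp v q μ) :
    Integrable (fun x => u x * v x) μ :=
  hu.integrable_mul hv

section
variable {d : ℕ} {Y : (l : ℕ) → Fin (harmonicDim d l) → USphere d → ℝ}

theorem IsHarmonicBasis.exists_polyFun (hY : IsHarmonicBasis d Y) (l : ℕ)
    (k : Fin (harmonicDim d l)) : ∃ P : MvPolynomial (Fin (d + 1)) ℝ,
      P.IsHomogeneous l ∧ polyLaplacian d P = 0 ∧ ∀ η : USphere d, Y l k η = polyFun P η := by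
  obtain ⟨P, ⟨h1, h2⟩, h3⟩ := hY.mem l k
  refine ⟨P, (MvPolynomial.mem_homogeneousSubmodule _ _).1 h1, h2, fun η => ?_⟩
  rw [← h3]
  rfl

theorem IsHarmonicBasis.continuous (hY : IsHarmonicBasis d Y) (l : ℕ)
    (k : Fin (harmonicDim d l)) : Continuous (Y l k) := by
  obtain ⟨P, -, -, h⟩ := hY.exists_polyFun l k
  rw [funext h]
  exact polyFun_continuous_sphere P

theorem Continuous.memLp_surfaceMeasure {u : USphere d → ℝ} (hu : Continuous u) (p : ℝ≥0∞) :
    MemLp u p (surfaceMeasure d) := by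
  obtain ⟨C, hC⟩ := (isCompact_univ (X := USphere d)).exists_bound_of_continuousOn hu.continuousOn
  exact MemLp.of_bound hu.aestronglyMeasurable C (Eventually.of_forall fun η => hC η trivial)

theorem IsHarmonicBasis.orthonormal (hY : IsHarmonicBasis d Y)
    (i j : Σ l : ℕ, Fin (harmonicDim d l)) :
    ∫ η, Y i.1 i.2 η * Y j.1 j.2 η ∂(surfaceMeasure d) = if i = j then 1 else 0 := by
  classical
  obtain ⟨b, hb⟩ := hY.basis
  have h := orthonormal_iff_ite.1 b.orthonormal i j
  rw [L2.inner_def] at h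
  convert h using 1
  · refine integral_congr_ae ?_
    filter_upwards [hb i.1 i.2, hb j.1 j.2] with η h1 h2
    rw [h1, h2]
    simp [mul_comm]

/-- Completeness gives `g = 0` almost everywhere, and continuity upgrades this to every point
because the surface measure charges all nonempty open sets. -/
theorem IsHarmonicBasis.eq_zero (hY : IsHarmonicBasis d Y) {g : USphere d → ℝ}
    (hg : Continuous g) (h0 : ∀ l k, harmonicCoeff d (Y l k) g = 0) : g = 0 := by
  obtain ⟨b, hb⟩ := hY.basis
  have hm := hg.memLp_surfaceMeasure 2
  have hz : hm.toLp g = 0 := by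
    refine b.repr.injective ?_
    rw [map_zero]
    refine lp.ext (funext fun ⟨l, k⟩ => ?_)
    rw [lp.coeFn_zero, Pi.zero_apply]
    refine (b.repr_apply_apply _ _).trans ?_
    rw [L2.inner_def, ← h0 l k, harmonicCoeff]
    refine integral_congr_ae ?_
    filter_upwards [hb l k, hm.coeFn_toLp] with η h1 h2
    rw [h1, h2]
    simp [mul_comm]
  have hae : g =ᵐ[surfaceMeasure d] 0 := by
    have h1 := hm.coeFn_toLp
    rw [hz] at h1
    exact h1.symm.trans (Lp.coeFn_zero _ _ _)
  exact (Continuous.ae_eq_iff_eq (surfaceMeasure d) hg continuous_zero).1 hae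

theorem harmonicCoeff_expansionSum (hY : IsHarmonicBasis d Y) (m : ℕ → ℝ) (g : USphere d → ℝ)
    {N l : ℕ} (hl : l < N) (k : Fin (harmonicDim d l)) :
    harmonicCoeff d (Y l k) (expansionSum d Y m g N) = m l * harmonicCoeff d (Y l k) g := by
  classical
  have hi : ∀ (l' : ℕ) (k' : Fin (harmonicDim d l')), Integrable (fun η =>
      m l' * harmonicCoeff d (Y l' k') g * (Y l' k' η * Y l k η)) (surfaceMeasure d) :=
    fun l' k' => (((hY.continuous l' k').mul (hY.continuous l k)).integrable_surfaceMeasure).const_mul _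
  rw [harmonicCoeff]
  simp only [expansionSum, Finset.sum_mul, mul_assoc (m _ * harmonicCoeff d _ g)]
  rw [integral_finsetSum _ fun l' _ => integrable_finsetSum _ fun k' _ => hi l' k',
    Finset.sum_eq_single l]
  · rw [integral_finsetSum _ fun k' _ => hi l k', Finset.sum_eq_single k]
    · rw [integral_const_mul, hY.orthonormal ⟨l, k⟩ ⟨l, k⟩]
      simp
    · intro k' _ hk'
      rw [integral_const_mul, hY.orthonormal ⟨l, k'⟩ ⟨l, k⟩]
      simp [hk']
    · simp
  · intro l' _ hl'
    rw [integral_finsetSum _ fun k' _ => hi l' k']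
    refine Finset.sum_eq_zero fun k' _ => ?_
    rw [integral_const_mul, hY.orthonormal ⟨l', k'⟩ ⟨l, k⟩]
    simp [hl']
  · simp [hl]

theorem continuous_expansionSum (hY : IsHarmonicBasis d Y) (m : ℕ → ℝ) (g : USphere d → ℝ)
    (N : ℕ) : Continuous (expansionSum d Y m g N) := by
  unfold expansionSum
  exact continuous_finsetSum _ fun l _ => continuous_finsetSum _ fun k _ =>
    continuous_const.mul (hY.continuous l k)

/-- Once `N > l`, the partial sums have a fixed coefficient against `Y l k`. Its difference from
that of `h` is bounded by an `L²` error that tends to zero. -/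
theorem IsD.harmonicCoeff_eq (hY : IsHarmonicBasis d Y) {g h : USphere d → ℝ}
    (hD : IsD d Y g h) (l : ℕ) (k : Fin (harmonicDim d l)) :
    harmonicCoeff d (Y l k) h = symbolD d l * harmonicCoeff d (Y l k) g := by
  have hYm := (hY.continuous l k).memLp_surfaceMeasure 2
  have hT := fun N => (continuous_expansionSum hY (symbolD d) g N).memLp_surfaceMeasure 2
  have hbound : ∀ N, l < N →
      |harmonicCoeff d (Y l k) h - symbolD d l * harmonicCoeff d (Y l k) g| ≤
      (eLpNorm (fun η => h η - expansionSum d Y (symbolD d) g N η) 2 (surfaceMeasure d)).toReal *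
        (eLpNorm (Y l k) 2 (surfaceMeasure d)).toReal := by
    intro N hN
    rw [← harmonicCoeff_expansionSum hY (symbolD d) g hN k, harmonicCoeff, harmonicCoeff,
      ← integral_sub (hD.1.integrable_fun_mul hYm) ((hT N).integrable_fun_mul hYm)]
    simp_rw [← sub_mul]
    exact abs_integral_mul_le_eLpNorm (hD.1.sub (hT N)) hYm
  have hlim := ((ENNReal.tendsto_toReal ENNReal.zero_ne_top).comp hD.2).mul_const
    (eLpNorm (Y l k) 2 (surfaceMeasure d)).toReal
  rw [ENNReal.toReal_zero, zero_mul] at hlim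
  have := ge_of_tendsto hlim (eventually_atTop.2 ⟨l + 1, fun N hN => hbound N hN⟩)
  exact sub_eq_zero.1 (abs_nonpos_iff.1 this)

/-! ### Kernel bounds and the single layer representation. -/

theorem newtonKernel_comm (x y : Amb d) : newtonKernel d x y = newtonKernel d y x := by
  rw [newtonKernel, newtonKernel, norm_sub_rev]

theorem newtonKernel_nonneg (x y : Amb d) : 0 ≤ newtonKernel d x y := by
  unfold newtonKernel; positivity

/-- The two spheres are at distance `1 - r`, so the diagonal and the default value of the inverse
there are never met. This bound drives every later integrability claim. -/
theorem newtonKernel_le {r : ℝ} (hr1 : r < 1) {x y : Amb d} (hx : ‖x‖ = 1) (hy : ‖y‖ = r) :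
    newtonKernel d x y ≤ ((1 - r) ^ (d - 1))⁻¹ := by
  have h1 : 0 < 1 - r := by linarith
  have h2 : 1 - r ≤ ‖x - y‖ := by
    rw [← hx, ← hy]; exact norm_sub_norm_le x y
  unfold newtonKernel
  gcongr

theorem measurable_newtonKernel : Measurable fun p : Amb d × Amb d => newtonKernel d p.1 p.2 := by
  unfold newtonKernel; fun_prop

/-- The single layer operator is thus symmetric, so in a double integral over `S^d` it can be moved
onto the spherical harmonic. -/
theorem newtonKernel_sphere_comm (r : ℝ) (x η : USphere d) :
    newtonKernel d x (r • (η : Amb d)) = newtonKernel d η (r • (x : Amb d)) := by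
  have h : ‖(x : Amb d) - r • (η : Amb d)‖ ^ 2 = ‖(η : Amb d) - r • (x : Amb d)‖ ^ 2 := by
    rw [norm_sub_sq_real, norm_sub_sq_real, inner_smul_right, inner_smul_right, norm_smul,
      norm_smul, norm_eq_of_mem_sphere, norm_eq_of_mem_sphere, real_inner_comm]
  have h' := (pow_left_inj₀ (norm_nonneg _) (norm_nonneg _) two_ne_zero).1 h
  rw [newtonKernel, newtonKernel, h']

/-- Integrability of the density against the Newtonian kernel on a product with a finite measure
on the unit sphere. -/
theorem integrable_newtonKernel_prod {r : ℝ} (hr : 0 ≤ r) (hr1 : r < 1) {h : USphere d → ℝ}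
    (hh : Integrable h (surfaceMeasure d)) (ν : Measure (Amb d)) [IsFiniteMeasure ν]
    (hν : ν (Metric.sphere 0 1)ᶜ = 0) :
    Integrable (fun p : Amb d × USphere d => newtonKernel d p.1 (r • (p.2 : Amb d)) * h p.2)
      (ν.prod (surfaceMeasure d)) := by
  have h1 : Integrable (fun p : Amb d × USphere d => h p.2) (ν.prod (surfaceMeasure d)) :=
    hh.comp_snd ν
  refine h1.bdd_mul (c := ((1 - r) ^ (d - 1))⁻¹)
    (f := fun p : Amb d × USphere d => newtonKernel d p.1 (r • (p.2 : Amb d))) ?_ ?_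
  · have hg : Measurable fun p : Amb d × USphere d => (p.1, r • (p.2 : Amb d)) :=
      measurable_fst.prodMk ((measurable_subtype_coe.comp measurable_snd).const_smul r)
    exact (measurable_newtonKernel.comp hg).aestronglyMeasurable
  · have h2 : ∀ᵐ y ∂ν, y ∈ Metric.sphere (0 : Amb d) 1 := hν
    have h3 : ∀ᵐ p ∂(ν.prod (surfaceMeasure d)), p.1 ∈ Metric.sphere (0 : Amb d) 1 :=
      Measure.quasiMeasurePreserving_fst.ae h2
    filter_upwards [h3] with p hp
    rw [Real.norm_of_nonneg (newtonKernel_nonneg _ _)]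
    exact newtonKernel_le hr1 (by simpa using hp) (norm_smul_sphere hr _)

/-- The exterior harmonic function is the single layer potential of `D(f)`. -/
theorem eq_single_layer (hd : 2 ≤ d) (hY : IsHarmonicBasis d Y) {r : ℝ} (hr : 0 < r) (hr1 : r < 1)
    {f : Amb d → ℝ} (hf : InnerProductSpace.HarmonicOnNhd f {x | r < ‖x‖})
    (hfc : ContinuousOn f {x | r ≤ ‖x‖}) (hf0 : Tendsto f (cocompact (Amb d)) (𝓝 0))
    {h : USphere d → ℝ} (hD : IsD d Y (scaled d r f) h) (x : USphere d) :
    f x = r ^ (d - 1) * ∫ η : USphere d, newtonKernel d x (r • (η : Amb d)) * h η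
      ∂(surfaceMeasure d) := by
  have hhi : Integrable h (surfaceMeasure d) := hD.1.integrable (by norm_num)
  have hfS : Continuous fun x : USphere d => f x :=
    hfc.comp_continuous continuous_subtype_val fun η => by
      rw [Set.mem_ofPred_eq, norm_eq_of_mem_sphere]; exact hr1.le
  set V : USphere d → ℝ := fun x => ∫ η : USphere d, newtonKernel d x (r • (η : Amb d)) * h η
      ∂(surfaceMeasure d) with hV
  have hmeas : ∀ x : USphere d, Continuous fun η : USphere d =>
      newtonKernel d x (r • (η : Amb d)) := fun x =>
    continuous_newtonKernel_sphere hr.le (by rw [norm_eq_of_mem_sphere]; exact hr1.ne)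
  have hVc : Continuous V := by
    refine continuous_of_dominated (bound := fun η => ((1 - r) ^ (d - 1))⁻¹ * ‖h η‖)
      (fun x => (hmeas x).aestronglyMeasurable.mul hhi.1) (fun x => Eventually.of_forall fun η => ?_)
      (hhi.norm.const_mul _) (Eventually.of_forall fun η => ?_)
    · rw [norm_mul, Real.norm_of_nonneg (newtonKernel_nonneg _ _)]
      exact mul_le_mul_of_nonneg_right (newtonKernel_le hr1 (norm_eq_of_mem_sphere x)
        (norm_smul_sphere hr.le _)) (norm_nonneg _)
    · simp_rw [newtonKernel_sphere_comm r _ η]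
      exact (hmeas η).mul continuous_const
  have hcoef : ∀ l k, harmonicCoeff d (Y l k) (fun x => f x - r ^ (d - 1) * V x) = 0 := by
    intro l k
    obtain ⟨P, hP, hΔ, hPY⟩ := hY.exists_polyFun l k
    have hYc := hY.continuous l k
    -- Fubini and the kernel symmetry let the operator act on `Y l k`, an eigenfunction, instead of
    -- on `h`.
    have hVY : symbolD d l * ∫ x, V x * Y l k x ∂(surfaceMeasure d) =
        r ^ l * harmonicCoeff d (Y l k) h := by
      have hprod : Integrable (fun p : USphere d × USphere d =>
          newtonKernel d p.1 (r • (p.2 : Amb d)) * h p.2 * Y l k p.1)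
          ((surfaceMeasure d).prod (surfaceMeasure d)) := by
        have h1 : Integrable (fun p : USphere d × USphere d => Y l k p.1 * h p.2)
            ((surfaceMeasure d).prod (surfaceMeasure d)) :=
          hYc.integrable_surfaceMeasure.mul_prod hhi
        have h2 := h1.bdd_mul (c := ((1 - r) ^ (d - 1))⁻¹)
          (f := fun p : USphere d × USphere d => newtonKernel d p.1 (r • (p.2 : Amb d)))
          (measurable_newtonKernel.comp (by fun_prop :
            Measurable fun p : USphere d × USphere d => ((p.1 : Amb d), r • (p.2 : Amb d)))
            ).aestronglyMeasurable
          (Eventually.of_forall fun p => by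
            rw [Real.norm_of_nonneg (newtonKernel_nonneg _ _)]
            exact newtonKernel_le hr1 (norm_eq_of_mem_sphere _) (norm_smul_sphere hr.le _))
        refine h2.congr (Eventually.of_forall fun p => ?_)
        simp only
        ring
      simp only [hV, ← integral_mul_const]
      rw [integral_integral_swap hprod, ← integral_const_mul, harmonicCoeff, ← integral_const_mul]
      refine integral_congr_ae (Eventually.of_forall fun η => ?_)
      have := integral_newtonKernel_mul_polyFun hd η hP hΔ ⟨hr, hr1⟩
      have e : ∫ x : USphere d, newtonKernel d x (r • (η : Amb d)) * h η * Y l k x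
          ∂(surfaceMeasure d) = h η * ∫ x : USphere d, newtonKernel d η (r • (x : Amb d)) *
            polyFun P x ∂(surfaceMeasure d) := by
        rw [← integral_const_mul]
        refine integral_congr_ae (Eventually.of_forall fun x => ?_)
        simp only
        rw [newtonKernel_sphere_comm, hPY]
        ring
      simp only
      rw [e, hPY]
      linear_combination h η * this
    rw [hD.harmonicCoeff_eq hY] at hVY
    have hs0 : symbolD d l ≠ 0 := by
      have h2 : (2 : ℝ) ≤ d := by exact_mod_cast hd
      have h3 := surfaceMeasure_real_univ_pos d
      rw [← sphereArea_eq] at h3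
      have h4 : (0 : ℝ) ≤ l := Nat.cast_nonneg l
      exact div_ne_zero (by nlinarith) (mul_ne_zero (by linarith) h3.ne')
    have hVY' : ∫ x, V x * Y l k x ∂(surfaceMeasure d) =
        r ^ l * harmonicCoeff d (Y l k) (scaled d r f) := by
      refine mul_left_cancel₀ hs0 ?_
      rw [hVY]; ring
    have hext := integral_sphere_exterior hd hr hr1 hf hfc hf0 hP hΔ
    have e1 : ∫ x : USphere d, f x * Y l k x ∂(surfaceMeasure d) =
        r ^ (l + d - 1) * harmonicCoeff d (Y l k) (scaled d r f) := by
      simp only [hPY, harmonicCoeff, scaled]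
      exact hext
    have hi1 : Integrable (fun x : USphere d => f x * Y l k x) (surfaceMeasure d) :=
      (hfS.mul hYc).integrable_surfaceMeasure
    have hi2 : Integrable (fun x : USphere d => V x * Y l k x) (surfaceMeasure d) :=
      (hVc.mul hYc).integrable_surfaceMeasure
    rw [harmonicCoeff]
    simp_rw [sub_mul, mul_assoc]
    rw [integral_sub hi1 (hi2.const_mul _), integral_const_mul, e1, hVY']
    have : l + d - 1 = d - 1 + l := by omega
    rw [this, pow_add]
    ring
  have := congrFun (hY.eq_zero (hfS.sub (continuous_const.mul hVc)) hcoef) x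
  exact sub_eq_zero.1 this

end

/-! ### Integrals over `rS^d` and against measures on `S^d`. -/

section
variable {d : ℕ} {r : ℝ}

/-- An embedding, rather than mere measurability, allows a change of variables for arbitrary
integrands. -/
theorem measurableEmbedding_smul_sphere (hr : r ≠ 0) :
    MeasurableEmbedding fun η : USphere d => r • (η : Amb d) :=
  ((Homeomorph.smulOfNeZero r hr).measurableEmbedding).comp
    (MeasurableEmbedding.subtype_coe Metric.isClosed_sphere.measurableSet)

instance (d : ℕ) (r : ℝ) : IsFiniteMeasure (sphereMeasure d r) :=
  Measure.smul_finite _ ENNReal.ofReal_ne_top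

theorem integral_sphereMeasure (hr : 0 < r) (g : Amb d → ℝ) :
    ∫ x, g x ∂(sphereMeasure d r) =
      r ^ d * ∫ η : USphere d, g (r • (η : Amb d)) ∂(surfaceMeasure d) := by
  rw [sphereMeasure, integral_smul_measure, (measurableEmbedding_smul_sphere hr.ne').integral_map,
    ENNReal.toReal_ofReal (pow_nonneg hr.le _), smul_eq_mul]

theorem ae_sphereMeasure_norm (hr : 0 < r) : ∀ᵐ x ∂(sphereMeasure d r), ‖x‖ = r := by
  refine Measure.ae_smul_measure ?_ _
  rw [(measurableEmbedding_smul_sphere hr.ne').ae_map_iff]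
  exact Eventually.of_forall fun η => norm_smul_sphere hr.le η

variable {ν : Measure (Amb d)} [IsFiniteMeasure ν]

theorem integrable_newtonKernel_of_norm_eq (hr1 : r < 1) (hν : ν (Metric.sphere 0 1)ᶜ = 0)
    {x : Amb d} (hx : ‖x‖ = r) : Integrable (newtonKernel d x) ν := by
  have h2 : ∀ᵐ y ∂ν, y ∈ Metric.sphere (0 : Amb d) 1 := hν
  refine Integrable.of_bound (measurable_newtonKernel.comp (by fun_prop :
      Measurable fun y : Amb d => (x, y))).aestronglyMeasurable ((1 - r) ^ (d - 1))⁻¹ ?_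
  filter_upwards [h2] with y hy
  rw [newtonKernel_comm, Real.norm_of_nonneg (newtonKernel_nonneg _ _)]
  exact newtonKernel_le hr1 (by simpa using hy) hx

theorem memLp_integral_newtonKernel (hr : 0 < r) (hr1 : r < 1) (hν : ν (Metric.sphere 0 1)ᶜ = 0)
    (p : ℝ≥0∞) : MemLp (fun x => ∫ y, newtonKernel d x y ∂ν) p (sphereMeasure d r) := by
  have h2 : ∀ᵐ y ∂ν, y ∈ Metric.sphere (0 : Amb d) 1 := hν
  refine MemLp.of_bound (measurable_newtonKernel.stronglyMeasurable.integral_prod_right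
    ).aestronglyMeasurable (((1 - r) ^ (d - 1))⁻¹ * ν.real Set.univ) ?_
  filter_upwards [ae_sphereMeasure_norm hr] with x hx
  refine norm_integral_le_of_norm_le_const ?_
  filter_upwards [h2] with y hy
  rw [newtonKernel_comm, Real.norm_of_nonneg (newtonKernel_nonneg _ _)]
  exact newtonKernel_le hr1 (by simpa using hy) hx

theorem integrable_of_continuousOn_sphere (hr1 : r < 1) (hν : ν (Metric.sphere 0 1)ᶜ = 0)
    {f : Amb d → ℝ} (hfc : ContinuousOn f {x | r ≤ ‖x‖}) : Integrable f ν := by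
  have hsub : Metric.sphere (0 : Amb d) 1 ⊆ {x | r ≤ ‖x‖} := fun x hx => by
    rw [Set.mem_ofPred_eq, mem_sphere_zero_iff_norm.1 hx]; exact hr1.le
  have h1 : IntegrableOn f (Metric.sphere 0 1) ν :=
    (hfc.mono hsub).integrableOn_compact (isCompact_sphere _ _)
  have h2 : ν.restrict (Metric.sphere 0 1) = ν := Measure.restrict_eq_self_of_ae_mem hν
  rwa [IntegrableOn, h2] at h1

theorem integral_eq_integral_sphereMeasure {Y : (l : ℕ) → Fin (harmonicDim d l) → USphere d → ℝ}
    (hd : 2 ≤ d) (hY : IsHarmonicBasis d Y) (hr : 0 < r) (hr1 : r < 1)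
    {f : Amb d → ℝ} (hf : InnerProductSpace.HarmonicOnNhd f {x | r < ‖x‖})
    (hfc : ContinuousOn f {x | r ≤ ‖x‖}) (hf0 : Tendsto f (cocompact (Amb d)) (𝓝 0))
    {Df : Amb d → ℝ} (hD : IsD d Y (scaled d r f) (scaled d r Df))
    (hν : ν (Metric.sphere 0 1)ᶜ = 0) :
    ∫ y, f y ∂ν = r⁻¹ * ∫ x, Df x * ∫ y, newtonKernel d x y ∂ν ∂(sphereMeasure d r) := by
  have h2 : ∀ᵐ y ∂ν, y ∈ Metric.sphere (0 : Amb d) 1 := hν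
  have hhi : Integrable (scaled d r Df) (surfaceMeasure d) := hD.1.integrable (by norm_num)
  -- The surface measure of `rS^d` absorbs `r^d`, leaving the factor `1/r` of the final estimate.
  have hr' : r ^ (d - 1) = r⁻¹ * r ^ d := by
    obtain ⟨n, rfl⟩ : ∃ n, d = n + 1 := ⟨d - 1, by omega⟩
    rw [Nat.add_sub_cancel, pow_succ]
    field_simp
  calc ∫ y, f y ∂ν = ∫ y, r ^ (d - 1) * ∫ η : USphere d, newtonKernel d y (r • (η : Amb d)) *
        scaled d r Df η ∂(surfaceMeasure d) ∂ν := by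
        refine integral_congr_ae ?_
        filter_upwards [h2] with y hy
        exact eq_single_layer hd hY hr hr1 hf hfc hf0 hD ⟨y, hy⟩
    _ = r ^ (d - 1) * ∫ η : USphere d, ∫ y, newtonKernel d y (r • (η : Amb d)) *
        scaled d r Df η ∂ν ∂(surfaceMeasure d) := by
        rw [integral_const_mul,
          integral_integral_swap (integrable_newtonKernel_prod hr.le hr1 hhi ν hν)]
    _ = _ := by
        rw [integral_sphereMeasure hr, ← mul_assoc, ← hr']
        congr 1
        refine integral_congr_ae (Eventually.of_forall fun η => ?_)
        simp only [integral_mul_const, scaled]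
        rw [mul_comm]
        simp_rw [newtonKernel_comm (r • (η : Amb d))]

end

/-! ### The final inequality. -/

theorem theorem2 (d : ℕ) (hd : 2 ≤ d) (r₀ r : ℝ) (hr₀ : 0 < r₀) (hr₀r : r₀ < r) (hr : r < 1)
    (Y : (l : ℕ) → Fin (harmonicDim d l) → USphere d → ℝ) (hY : IsHarmonicBasis d Y)
    (f : Amb d → ℝ)
    (hf_harm : InnerProductSpace.HarmonicOnNhd f {x | r < ‖x‖})
    (hf_cont : ContinuousOn f {x | r ≤ ‖x‖})
    (hf_inf : Tendsto f (cocompact (Amb d)) (𝓝 0))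
    (Df : Amb d → ℝ)
    (hDf : IsD d Y (scaled d r f) (scaled d r Df))
    (hDf_bdd : MemLp Df ∞ (sphereMeasure d r))
    (hf_exp : EqualsExpansion d Y (scaled d r f))
    (p p' : ℝ≥0∞) (hp : 1 ≤ p) (hp' : 1 ≤ p') (hpp' : 1 / p + 1 / p' = 1)
    (σ : SignedMeasure (Amb d)) (hσ : IsAdmissible d σ) :
    SignedIntegrable d σ f ∧
    (∀ x ∈ Metric.sphere (0 : Amb d) r,
      SignedIntegrable d σ (fun y => (‖x - y‖ ^ (d - 1))⁻¹)) ∧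
    MemLp Df p (sphereMeasure d r) ∧
    MemLp (newtonPotential d σ) p' (sphereMeasure d r) ∧
    |signedIntegral d σ f| ≤
      1 / r₀ * (eLpNorm Df p (sphereMeasure d r)).toReal *
        (eLpNorm (newtonPotential d σ) p' (sphereMeasure d r)).toReal := by
  have hr0 : 0 < r := hr₀.trans hr₀r
  have hDp : MemLp Df p (sphereMeasure d r) := hDf_bdd.mono_exponent le_top
  have hpos : ∀ q, MemLp (fun x => ∫ y, newtonKernel d x y ∂σ.toJordanDecomposition.posPart) q
      (sphereMeasure d r) := memLp_integral_newtonKernel hr0 hr hσ.supp_pos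
  have hneg : ∀ q, MemLp (fun x => ∫ y, newtonKernel d x y ∂σ.toJordanDecomposition.negPart) q
      (sphereMeasure d r) := memLp_integral_newtonKernel hr0 hr hσ.supp_neg
  have hU : MemLp (newtonPotential d σ) p' (sphereMeasure d r) := (hpos p').sub (hneg p')
  refine ⟨⟨integrable_of_continuousOn_sphere hr hσ.supp_pos hf_cont,
    integrable_of_continuousOn_sphere hr hσ.supp_neg hf_cont⟩, fun x hx =>
    ⟨integrable_newtonKernel_of_norm_eq hr hσ.supp_pos (mem_sphere_zero_iff_norm.1 hx),
    integrable_newtonKernel_of_norm_eq hr hσ.supp_neg (mem_sphere_zero_iff_norm.1 hx)⟩,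
    hDp, hU, ?_⟩
  -- An exact identity, obtained by subtracting the representations for the positive and negative
  -- parts of `σ`.
  have hrep : signedIntegral d σ f =
      r⁻¹ * ∫ x, Df x * newtonPotential d σ x ∂(sphereMeasure d r) := by
    have hD1 : MemLp Df 1 (sphereMeasure d r) := hDf_bdd.mono_exponent le_top
    rw [signedIntegral, integral_eq_integral_sphereMeasure hd hY hr0 hr hf_harm hf_cont hf_inf hDf
      hσ.supp_pos, integral_eq_integral_sphereMeasure hd hY hr0 hr hf_harm hf_cont hf_inf hDf
      hσ.supp_neg, ← mul_sub, ← integral_sub (hD1.integrable_fun_mul (hpos ∞))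
      (hD1.integrable_fun_mul (hneg ∞))]
    simp_rw [← mul_sub]
    rfl
  have : ENNReal.HolderTriple p p' 1 := ⟨by simpa using hpp'⟩
  rw [hrep, abs_mul, abs_of_pos (inv_pos.2 hr0), mul_assoc, ← one_div]
  -- The factor `1/r` is weakened to `1/r₀`; what remains is Hölder's inequality.
  gcongr
  exact abs_integral_mul_le_eLpNorm hDp hU
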